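/- **Setting.** Let $n\ge1$, $N\ge2$, and let $\mathcal G=(\mathcal V,\mathcal E)$ be a connected undirected graph on $\mathcal V=\{1,\dots,N\}$, with neighbor sets $\mathcal N_i$ and Laplacian $L_{\mathcal G}$, whose second smallest and largest eigenvalues are $\lambda_2(L_{\mathcal G})$ and $\lambda_{\max}(L_{\mathcal G})$. For each $i$ let $f_i:\mathbb R^n\to\mathbb R$ be twice continuously differentiable and locally strongly convex (for every convex compact set $\mathcal C$ there is $c>0$ with $\nabla^2f_i\succeq cI_n$ on $\mathcal C$), have a minimizer $x_i^0$, and have a Hessian that is Lipschitz on every compact set. Let $x^*$ be the minimizer of $\sum_i f_i$, put $D_i(x)=f_i(x^*)-f_i(x)-\nabla f_i(x)^T(x^*-x)$, and assume that each $D_i$ is coercive. For stacked vectors $\mathbf x=[x_1;\dots;x_N]\in\mathbb R^{nN}$ let $V(\mathbf x)=\sum_i D_i(x_i)$; write $\mathbf x^0=[x_1^0;\dots;x_N^0]$, $\mathbf x^*=[x^*;\dots;x^*]$, $V_0=V(\mathbf x^0)$, and $\mathcal C_i=\{x: D_i(x)\le V_0\}$. **Constants.** Let $\theta_i,\Theta_i>0$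 and $L_i\ge0$ be such that $\theta_iI_n\preceq\nabla^2f_i\preceq\Theta_iI_n$ and $\nabla^2f_i$ is $L_i$-Lipschitz (spectral norm) on $\operatorname{conv}\mathcal C_i$; let $\theta=\min_i\theta_i$, $\Theta=\max_i\Theta_i$; let $\bar\theta_i>0$ be such that $\nabla^2 f_i\succeq\bar\theta_iI_n$ on $\operatorname{conv}\bigcup_j\mathcal C_j$. Fix $\bar\alpha>0$, let $\delta_i=\frac{\bar\alpha}{\theta_i}\sum_{j\in\mathcal N_i}\big(\sqrt{2V_0/\theta_i}+\sqrt{2V_0/\theta_j}\big)$ and $\mathcal C_i'=\operatorname{conv}\{x:\|x-y\|\le\delta_i\text{ for some }y\in\mathcal C_i\}$, and let $0<\theta_i'\le\theta_i$, $\Theta_i'\ge\Theta_i$, $L_i'\ge L_i$ be such that $\theta_i'I_n\preceq\nabla^2f_i\preceq\Theta_i'I_n$ and $\nabla^2f_i$ is $L_i'$-Lipschitz on $\mathcal C_i'$. **Algorithm.** For step sizes $\alpha_{\{i,j\}}$, $\{i,j\}\in\mathcal E$, and $g_{\{i,j\}}(x)=\frac12x^Tx$, let $\mathbf x^k$ be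 generated from $\mathbf x^0$ by $$x_i^{k+1}=x_i^k+(\nabla^2f_i(x_i^k))^{-1}\sum_{j\in\mathcal N_i}\alpha_{\{i,j\}}\big(\nabla g_{\{i,j\}}(x_j^k)-\nabla g_{\{i,j\}}(x_i^k)\big).$$ **Theorem.** (a) Suppose that for all $\{i,j\}\in\mathcal E$: $0<\alpha_{\{i,j\}}\le\bar\alpha$, $\alpha_{\{i,j\}}<\theta/\max_{l}|\mathcal N_l|$, and $$\alpha_{\{i,j\}}<\frac12\min_{l\in\{i,j\}}\frac{\theta_l^2}{|\mathcal N_l|}\Big(\Theta_l'-\frac{\theta_l'}2+\frac{L_l'}2\sqrt{\frac{2V_0}{\theta_l}}\Big)^{-1}.$$ Let $$q=\max\Big\{\frac{\max_{\mathcal E}\alpha_{\{i,j\}}\,\lambda_{\max}(L_{\mathcal G})}{\theta}-1,\;1-\frac{\min_{\mathcal E}\alpha_{\{i,j\}}\,\lambda_2(L_{\mathcal G})}{\Theta}\Big\}.$$ Then $q\in[0,1)$, and $q>0$ except possibly when $\mathcal G$ is complete, $\theta=\Theta$ and all $\alpha_{\{i,j\}}$ equal $\theta/N$. Moreover $$\tilde\rho_i=\frac{\theta_i^2}{2|\mathcal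 N_i|\max_{j\in\mathcal N_i}\alpha_{\{i,j\}}}+\frac{\theta_i}2-\Theta_i-\frac{L_i}2\sqrt{\frac{2V_0}{\theta_i}}>0\quad\text{for all }i,$$ and there is $\tilde{\mathbf x}=[\tilde x;\dots;\tilde x]$, $\tilde x\in\mathbb R^n$, such that for all $k\ge0$ $$\|\mathbf x^k-\tilde{\mathbf x}\|\le\frac{\max_{\mathcal E}\alpha_{\{i,j\}}\,\lambda_{\max}(L_{\mathcal G})}{\theta(1-q)}\,\|\mathbf x^0\|\,q^k,\qquad \|\tilde{\mathbf x}-\mathbf x^*\|\le\max_i\frac{L_i}{\tilde\rho_i}\cdot\frac{\sqrt N\,V_0}{2\sum_i\bar\theta_i}$$ (with $0^0=1$). (b) The last bound is $O(\max_{\mathcal E}\alpha_{\{i,j\}})$ as the step sizes tend to $0$: there are $C,\alpha_0>0$, independent of the step sizes, such that it is at most $C\max_{\mathcal E}\alpha_{\{i,j\}}$ whenever $0<\alpha_{\{i,j\}}\le\alpha_0$ for all $\{i,j\}\in\mathcal E$. -/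

import Mathlib

noncomputable section

namespace DEAN

/-- `ℝⁿ` with the Euclidean norm. -/
abbrev E (n : ℕ) : Type := EuclideanSpace ℝ (Fin n)

/-- `ℝ^{nN}`, seen as stacked vectors `[z₁; …; z_N]` with `z_i ∈ ℝⁿ`; the norm is the Euclidean
norm `√(∑ ‖z_i‖²)`. -/
abbrev Stack (N n : ℕ) : Type := PiLp 2 (fun _ : Fin N => E n)

/-- The consensus vector `[z; …; z]`. -/
def consensus (N : ℕ) {n : ℕ} (z : E n) : Stack N n := WithLp.toLp 2 (fun _ => z)

/-- The Hessian of `f` at `x`, as a linear operator (the derivative of the gradient). -/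
def hess {n : ℕ} (f : E n → ℝ) (x : E n) : E n →L[ℝ] E n := fderiv ℝ (gradient f) x

/-- `∇²f(x) ⪰ c I` for all `x ∈ S`. -/
def HessLowerBound {n : ℕ} (f : E n → ℝ) (S : Set (E n)) (c : ℝ) : Prop :=
  ∀ x ∈ S, ∀ v : E n, c * ‖v‖ ^ 2 ≤ inner ℝ v (hess f x v)

/-- `C I ⪰ ∇²f(x)` for all `x ∈ S`. -/
def HessUpperBound {n : ℕ} (f : E n → ℝ) (S : Set (E n)) (C : ℝ) : Prop :=
  ∀ x ∈ S, ∀ v : E n, inner ℝ v (hess f x v) ≤ C * ‖v‖ ^ 2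

/-- `∇²f` is Lipschitz on `S` with constant `L` (spectral norm). -/
def HessLipschitz {n : ℕ} (f : E n → ℝ) (S : Set (E n)) (L : ℝ) : Prop :=
  ∀ x ∈ S, ∀ y ∈ S, ‖hess f x - hess f y‖ ≤ L * ‖x - y‖

/-- Local strong convexity: a positive convexity parameter on every convex compact set. -/
def LocallyStronglyConvex {n : ℕ} (f : E n → ℝ) : Prop :=
  ∀ S : Set (E n), Convex ℝ S → IsCompact S → ∃ c > 0, HessLowerBound f S c

/-- Local Lipschitz continuity of the Hessian: a Lipschitz constant on every compact set. -/
def LocallyLipschitzHess {n : ℕ} (f : E n → ℝ) : Prop :=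
  ∀ S : Set (E n), IsCompact S → ∃ L ≥ 0, HessLipschitz f S L

/-- The standing assumption on a local objective: twice continuously differentiable, locally
strongly convex, with a minimizer and a locally Lipschitz Hessian. -/
structure ObjectiveAssumption {n : ℕ} (f : E n → ℝ) : Prop where
  contDiff : ContDiff ℝ 2 f
  stronglyConvex : LocallyStronglyConvex f
  hasMinimizer : ∃ x, IsMinOn f Set.univ x
  lipschitzHess : LocallyLipschitzHess f

/-- `f(y) - f(x) - ∇f(x)ᵀ(y - x)`. -/
def bregman {n : ℕ} (f : E n → ℝ) (y x : E n) : ℝ :=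
  f y - f x - inner ℝ (gradient f x) (y - x)

/-- The Lyapunov function `V(𝐱) = ∑ᵢ f_i(x*) - f_i(x_i) - ∇f_i(x_i)ᵀ(x* - x_i)`. -/
def V {N n : ℕ} (f : Fin N → E n → ℝ) (xs : E n) (x : Stack N n) : ℝ :=
  ∑ i, bregman (f i) xs (x i)

/-- The sublevel set `C_i`. -/
def Cset {N n : ℕ} (f : Fin N → E n → ℝ) (xs : E n) (x0 : Stack N n) (i : Fin N) : Set (E n) :=
  {x | bregman (f i) xs x ≤ V f xs x0}

/-- One DEAN update, with surrogate functions `g_{i,j}` and step sizes `α_{i,j}` attached to the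
links: `x_i ↦ x_i + (∇²f_i(x_i))⁻¹ ∑_{j ∈ N_i} α_{i,j} (∇g_{i,j}(x_j) - ∇g_{i,j}(x_i))`. -/
def step {N n : ℕ} (G : SimpleGraph (Fin N)) [DecidableRel G.Adj] (f : Fin N → E n → ℝ)
    (g : Sym2 (Fin N) → E n → ℝ) (α : Sym2 (Fin N) → ℝ) (x : Stack N n) : Stack N n :=
  WithLp.toLp 2 fun i => x i + (hess (f i) (x i)).inverse
    (∑ j ∈ G.neighborFinset i,
      α s(i, j) • (gradient (g s(i, j)) (x j) - gradient (g s(i, j)) (x i)))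

/-- The DEAN iterates started at `x0`. -/
def iterate {N n : ℕ} (G : SimpleGraph (Fin N)) [DecidableRel G.Adj] (f : Fin N → E n → ℝ)
    (g : Sym2 (Fin N) → E n → ℝ) (α : Sym2 (Fin N) → ℝ) (x0 : Stack N n) : ℕ → Stack N n
  | 0 => x0
  | k + 1 => step G f g α (iterate G f g α x0 k)

/-- The surrogate functions `g_{i,j}(x) = ½ xᵀx`. -/
def quadSurrogate (N n : ℕ) : Sym2 (Fin N) → E n → ℝ := fun _ x => (1 / 2) * inner ℝ x x

/-- The radius `δ_i`; `v0` stands for `V(𝐱⁰)`, and `Γ_{i,j} = 1`, which is the Lipschitz constant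
of the gradient of `½ xᵀx`. -/
def delta {N : ℕ} (G : SimpleGraph (Fin N)) [DecidableRel G.Adj] (αbar v0 : ℝ) (θ : Fin N → ℝ)
    (i : Fin N) : ℝ :=
  αbar / θ i * ∑ j ∈ G.neighborFinset i, (√(2 * v0 / θ i) + √(2 * v0 / θ j))

/-- The enlarged set `C'_i = conv {x : ‖x - y‖ ≤ δ_i for some y ∈ C_i}`. -/
def Cset' {N n : ℕ} (G : SimpleGraph (Fin N)) [DecidableRel G.Adj] (f : Fin N → E n → ℝ)
    (xs : E n) (x0 : Stack N n) (αbar : ℝ) (θ : Fin N → ℝ) (i : Fin N) : Set (E n) :=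
  convexHull ℝ {x | ∃ y ∈ Cset f xs x0 i, ‖x - y‖ ≤ delta G αbar (V f xs x0) θ i}

/-- `(θ_i² / |N_i|) (Θ'_i - θ'_i / 2 + (L'_i / 2) √(2 V(𝐱⁰) / θ_i))⁻¹`. -/
def stepTerm {N : ℕ} (G : SimpleGraph (Fin N)) [DecidableRel G.Adj] (v0 : ℝ)
    (θ θ' Θ' L' : Fin N → ℝ) (i : Fin N) : ℝ :=
  θ i ^ 2 / (G.degree i : ℝ) * (Θ' i - θ' i / 2 + L' i / 2 * √(2 * v0 / θ i))⁻¹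

/-- The step-size condition (with `Γ_{i,j} = 1`) that makes the Lyapunov function decrease. -/
def StepSizeDrop {N : ℕ} (G : SimpleGraph (Fin N)) [DecidableRel G.Adj] (v0 : ℝ)
    (θ θ' Θ' L' : Fin N → ℝ) (α : Sym2 (Fin N) → ℝ) : Prop :=
  ∀ i j, G.Adj i j →
    α s(i, j) < 1 / 2 * min (stepTerm G v0 θ θ' Θ' L' i) (stepTerm G v0 θ θ' Θ' L' j)

/-- The `k`-th smallest eigenvalue of a symmetric matrix, counted with multiplicity and starting
from `k = 0` (Mathlib lists the eigenvalues in decreasing order). -/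
def eigAsc {N : ℕ} {A : Matrix (Fin N) (Fin N) ℝ} (hA : A.IsHermitian) (k : Fin N) : ℝ :=
  hA.eigenvalues₀ (Fin.cast (Fintype.card_fin N).symm k.rev)

/-- `λ₂` of the graph Laplacian. -/
def lam2 {N : ℕ} (hN : 2 ≤ N) (G : SimpleGraph (Fin N)) [DecidableRel G.Adj] : ℝ :=
  eigAsc (G.isHermitian_lapMatrix (R := ℝ)) ⟨1, by omega⟩

/-- `λ_max` of the graph Laplacian. -/
def lamMax {N : ℕ} (hN : 2 ≤ N) (G : SimpleGraph (Fin N)) [DecidableRel G.Adj] : ℝ :=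
  eigAsc (G.isHermitian_lapMatrix (R := ℝ)) ⟨N - 1, by omega⟩

/-- The largest step size over the links. -/
def alphaMax {N : ℕ} (G : SimpleGraph (Fin N)) (α : Sym2 (Fin N) → ℝ) : ℝ :=
  ⨆ e : G.edgeSet, α e

/-- The smallest step size over the links. -/
def alphaMin {N : ℕ} (G : SimpleGraph (Fin N)) (α : Sym2 (Fin N) → ℝ) : ℝ :=
  ⨅ e : G.edgeSet, α e

/-- The rate `q = max {max α · λ_max / θ - 1, 1 - min α · λ₂ / Θ}`, where `θ = min θ_i` and
`Θ = max Θ_i`. -/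
def rate {N : ℕ} (hN : 2 ≤ N) (G : SimpleGraph (Fin N)) [DecidableRel G.Adj]
    (θ Θ : Fin N → ℝ) (α : Sym2 (Fin N) → ℝ) : ℝ :=
  max (alphaMax G α * lamMax hN G / (⨅ i, θ i) - 1) (1 - alphaMin G α * lam2 hN G / (⨆ i, Θ i))

/-- `ρ̃_i = θ_i² / (2 |N_i| max_{j ∈ N_i} α_{i,j}) + θ_i / 2 - Θ_i - (L_i / 2) √(2 V(𝐱⁰) / θ_i)`. -/
def rho {N : ℕ} (G : SimpleGraph (Fin N)) [DecidableRel G.Adj] (v0 : ℝ) (θ Θ L : Fin N → ℝ)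
    (α : Sym2 (Fin N) → ℝ) (i : Fin N) : ℝ :=
  θ i ^ 2 / (2 * (G.degree i : ℝ) * ⨆ j : G.neighborSet i, α s(i, (j : Fin N)))
    + θ i / 2 - Θ i - L i / 2 * √(2 * v0 / θ i)

/-- The bound `max_i (L_i / ρ̃_i) · √N V(𝐱⁰) / (2 ∑ᵢ θ̄_i)` on the optimality error. -/
def errorBound {N : ℕ} (G : SimpleGraph (Fin N)) [DecidableRel G.Adj] (v0 : ℝ)
    (θ Θ L θbar : Fin N → ℝ) (α : Sym2 (Fin N) → ℝ) : ℝ :=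
  (⨆ i, L i / rho G v0 θ Θ L α i) * (√(N : ℝ) * v0 / (2 * ∑ i, θbar i))

end DEAN

end

/-! Write W for the α-weighted Laplacian `wlap` on stacked vectors. With the quadratic surrogate the
update is a preconditioned Richardson step x ↦ x - H(x)⁻¹ W x, where H(x) is the block-diagonal
Hessian (`step_quadSurrogate`).

Rate: put Q(x) = ⟨x, W x⟩. Since ‖W y‖² lies between min α · λ₂ · Q(y) and max α · λ_max · Q(y), and
H⁻¹ between 1/Θ and 1/θ, the ratio ⟨W y, H⁻¹ W y⟩ / Q(y) lies in [1 - q, 1 + q] whenever Q(y) > 0.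
As I - H⁻¹W is symmetric for the energy form, one step contracts Q by q² (`energy_sub_comp_le`,
`energy_step_le`). Displacements are bounded by ‖W x‖/θ, so they decay like qᵏ. Their sum converges,
and the limit has zero energy, so it is a consensus vector (`exists_consensus_limit`).

Invariance: the Hessian bounds hold only near the sets C_i, so the iterates must stay there. A
three-point identity for Bregman distances shows that V changes by -Q plus quadratic terms in the
displacement. Cauchy–Schwarz at each node makes Q dominate these terms for small steps
(`V_step_add_le`). The constants on C'_i give descent first, because a step from C_i cannot leave
C'_i (`V_step_le`). Descent puts both endpoints in C_i, where the same estimate holds with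
coefficients ρ̃_i (`V_step_add_rho_le`).

Optimality: the sum of local gradients is zero at the start. A step changes it only to second order,
because the components of W x sum to zero. The remainder is paid for by the decrease of V, so the
gradient sum telescopes to at most max(L_i/ρ̃_i) · V₀/2 in the limit. Strong monotonicity turns this
into a distance to the optimum. -/

noncomputable section

namespace DEAN

/-! ### Symmetric operators and contraction in the energy form -/

section SymmetricOperators

variable {F : Type*} [NormedAddCommGroup F] [InnerProductSpace ℝ F]

/-- Nonnegativity of the form at x - c⁻¹ T x, with the upper bound applied to T x, gives this
without any spectral theorem. -/
theorem norm_apply_sq_le_of_inner_le {T : F →ₗ[ℝ] F} (hT : T.IsSymmetric)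
    (hpos : ∀ x, 0 ≤ inner ℝ x (T x)) {c : ℝ} (hc : 0 < c)
    (hle : ∀ x, inner ℝ x (T x) ≤ c * ‖x‖ ^ 2) (x : F) :
    ‖T x‖ ^ 2 ≤ c * inner ℝ x (T x) := by
  have h1 := hpos (x - c⁻¹ • T x)
  have h2 := hle (T x)
  have h3 : inner ℝ x (T (T x)) = ‖T x‖ ^ 2 := by
    rw [← hT x (T x), real_inner_self_eq_norm_sq]
  simp only [map_sub, map_smul, inner_sub_left, inner_sub_right, real_inner_smul_left,
    real_inner_smul_right, h3, real_inner_self_eq_norm_sq] at h1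
  have h4 : c⁻¹ * (c⁻¹ * inner ℝ (T x) (T (T x))) ≤ c⁻¹ * (c⁻¹ * (c * ‖T x‖ ^ 2)) := by
    gcongr
  have h5 : c⁻¹ * (c⁻¹ * (c * ‖T x‖ ^ 2)) = c⁻¹ * ‖T x‖ ^ 2 := by
    field_simp
  have h6 : c⁻¹ * ‖T x‖ ^ 2 ≤ inner ℝ x (T x) := by linarith
  calc ‖T x‖ ^ 2 = c * (c⁻¹ * ‖T x‖ ^ 2) := by field_simp
    _ ≤ c * inner ℝ x (T x) := by gcongr

/-- Under a preconditioned Richardson step `x ↦ x - M T x` the energy `⟨x, T x⟩` contracts by the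
square of the numerical radius of the iteration operator in the energy form. -/
theorem energy_sub_comp_le {T M : F →ₗ[ℝ] F} (hT : T.IsSymmetric) (hM : M.IsSymmetric)
    {q : ℝ} (hq : 0 ≤ q)
    (hle : ∀ x, |inner ℝ x (T x) - inner ℝ (T x) (M (T x))| ≤ q * inner ℝ x (T x)) (x : F) :
    inner ℝ (x - M (T x)) (T (x - M (T x))) ≤ q ^ 2 * inner ℝ x (T x) := by
  set a := inner ℝ (x - M (T x)) (T (x - M (T x))) with ha
  set b := inner ℝ x (T x) with hb
  -- Polarization: with z = x - M T x, the form ⟨·, T ·⟩ - ⟨T ·, M T ·⟩ pairs x and z to exactly a.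
  -- Comparing its values at x + t z and x - t z bounds 4ta. The choice t = q⁻¹ below is optimal; q
  -- = 0 needs its own case.
  have key : ∀ t : ℝ, 4 * t * a ≤ 2 * q * (b + t ^ 2 * a) := by
    intro t
    set z := x - M (T x) with hz
    have h1 := (abs_le.mp (hle (x + t • z))).2
    have h2 := (abs_le.mp (hle (x - t • z))).1
    have e1 : inner ℝ z (T x) = inner ℝ x (T z) := by
      rw [← hT x z, real_inner_comm]
    have e2 : inner ℝ (T z) (M (T x)) = inner ℝ (T x) (M (T z)) := by
      rw [← hM, real_inner_comm]
    have e3 : inner ℝ x (T z) - inner ℝ (T x) (M (T z)) = a := by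
      rw [← hM (T x) (T z), ← inner_sub_left]
    simp only [map_add, map_sub, map_smul, inner_add_left, inner_sub_left, inner_add_right,
      inner_sub_right, real_inner_smul_left, real_inner_smul_right, e1, e2] at h1 h2
    linear_combination h1 + h2 - 4 * t * e3
  rcases hq.eq_or_lt with h0 | h0
  · have := key 1
    rw [← h0] at this ⊢
    nlinarith
  · have := key q⁻¹
    have h2 : 4 * q⁻¹ * a * q = 4 * a := by field_simp
    have h3 : 2 * q * (b + q⁻¹ ^ 2 * a) * q = 2 * q ^ 2 * b + 2 * a := by field_simp
    have h4 := mul_le_mul_of_nonneg_right this h0.le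
    rw [h2, h3] at h4
    linarith

end SymmetricOperators

/-! ### Spectrum of the graph Laplacian -/

section LaplacianSpectrum

open Matrix

theorem eigAsc_mono {N : ℕ} {A : Matrix (Fin N) (Fin N) ℝ} (hA : A.IsHermitian) :
    Monotone (eigAsc hA) := fun i j hij =>
  hA.eigenvalues₀_antitone (by simpa [Fin.le_def] using Fin.rev_le_rev.mpr hij)

theorem exists_eigenbasis_eigAsc {N : ℕ} {A : Matrix (Fin N) (Fin N) ℝ} (hA : A.IsHermitian) :
    ∃ b : OrthonormalBasis (Fin N) ℝ (EuclideanSpace ℝ (Fin N)),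
      ∀ k, A *ᵥ (b k).ofLp = eigAsc hA k • (b k).ofLp := by
  -- Reversal and cast match `eigAsc`; the last factor is the equivalence relating `eigenvalues` to
  -- `eigenvalues₀`.
  let e : Fin N ≃ Fin N := (Fin.revPerm.trans (finCongr (Fintype.card_fin N).symm)).trans
    (Fintype.equivOfCardEq (Fintype.card_fin _))
  refine ⟨hA.eigenvectorBasis.reindex e.symm, fun k => ?_⟩
  rw [OrthonormalBasis.reindex_apply, Equiv.symm_symm, hA.mulVec_eigenvectorBasis]
  congr 1
  simp [Matrix.IsHermitian.eigenvalues, eigAsc, e]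

theorem dotProduct_eq_inner {N : ℕ} (v w : Fin N → ℝ) :
    v ⬝ᵥ w = inner ℝ (WithLp.toLp 2 v) (WithLp.toLp 2 w) := by
  simp [PiLp.inner_apply, dotProduct, mul_comm]

theorem dotProduct_mulVec_eq_sum_eigAsc {N : ℕ} {A : Matrix (Fin N) (Fin N) ℝ}
    (hA : A.IsHermitian) {b : OrthonormalBasis (Fin N) ℝ (EuclideanSpace ℝ (Fin N))}
    (hb : ∀ k, A *ᵥ (b k).ofLp = eigAsc hA k • (b k).ofLp) (v : Fin N → ℝ) :
    v ⬝ᵥ A *ᵥ v = ∑ k, eigAsc hA k * inner ℝ (b k) (WithLp.toLp 2 v) ^ 2 := by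
  rw [dotProduct_eq_inner, ← b.sum_inner_mul_inner]
  refine Finset.sum_congr rfl fun k _ => ?_
  have h : inner ℝ (b k) (WithLp.toLp 2 (A *ᵥ v))
      = eigAsc hA k * inner ℝ (b k) (WithLp.toLp 2 v) := by
    have hs : Aᵀ = A := by simpa [conjTranspose_eq_transpose_of_trivial] using hA.eq
    have e1 : inner ℝ (b k) (WithLp.toLp 2 (A *ᵥ v)) = (b k).ofLp ⬝ᵥ (A *ᵥ v) := by
      rw [dotProduct_eq_inner]
    have e2 : inner ℝ (b k) (WithLp.toLp 2 v) = (b k).ofLp ⬝ᵥ v := by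
      rw [dotProduct_eq_inner]
    rw [e1, e2, dotProduct_mulVec, ← mulVec_transpose, hs, hb, smul_dotProduct, smul_eq_mul]
  rw [h, real_inner_comm]
  ring

theorem sum_inner_sq_eigenbasis {N : ℕ} (b : OrthonormalBasis (Fin N) ℝ (EuclideanSpace ℝ (Fin N)))
    (v : Fin N → ℝ) : ∑ k, inner ℝ (b k) (WithLp.toLp 2 v) ^ 2 = v ⬝ᵥ v := by
  rw [dotProduct_eq_inner, ← b.sum_inner_mul_inner]
  exact Finset.sum_congr rfl fun k _ => by rw [real_inner_comm, sq]

variable {N : ℕ} (G : SimpleGraph (Fin N)) [DecidableRel G.Adj]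

theorem dotProduct_lapMatrix_mulVec (v : Fin N → ℝ) :
    v ⬝ᵥ G.lapMatrix ℝ *ᵥ v = (∑ i, ∑ j, if G.Adj i j then (v i - v j) ^ 2 else 0) / 2 := by
  rw [← G.lapMatrix_toLinearMap₂' ℝ v, toLinearMap₂'_apply']

theorem dotProduct_lapMatrix_mulVec_le_lamMax (hN : 2 ≤ N) (v : Fin N → ℝ) :
    v ⬝ᵥ G.lapMatrix ℝ *ᵥ v ≤ lamMax hN G * (v ⬝ᵥ v) := by
  obtain ⟨b, hb⟩ := exists_eigenbasis_eigAsc (G.isHermitian_lapMatrix (R := ℝ))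
  rw [dotProduct_mulVec_eq_sum_eigAsc _ hb, ← sum_inner_sq_eigenbasis b, Finset.mul_sum]
  gcongr with k
  exact eigAsc_mono _ (Fin.le_def.mpr (by simp; omega))

variable {G}

theorem eq_of_lapMatrix_mulVec_eq_zero (hG : G.Connected) {v : Fin N → ℝ}
    (hv : G.lapMatrix ℝ *ᵥ v = 0) (i j : Fin N) : v i = v j :=
  (G.lapMatrix_mulVec_eq_zero_iff_forall_reachable.mp hv) i j (hG.preconnected i j)

theorem eigAsc_lapMatrix_zero (hN : 2 ≤ N) :
    eigAsc (G.isHermitian_lapMatrix (R := ℝ)) ⟨0, by omega⟩ = 0 := by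
  obtain ⟨b, hb⟩ := exists_eigenbasis_eigAsc (G.isHermitian_lapMatrix (R := ℝ))
  set ev := eigAsc (G.isHermitian_lapMatrix (R := ℝ))
  have hN0 : 0 < N := by omega
  apply le_antisymm
  · have h1 := dotProduct_mulVec_eq_sum_eigAsc _ hb (fun _ => (1 : ℝ))
    have h2 := sum_inner_sq_eigenbasis b (fun _ => (1 : ℝ))
    have h3 : ev ⟨0, hN0⟩ * ∑ k, inner ℝ (b k) (WithLp.toLp 2 fun _ => (1 : ℝ)) ^ 2
        ≤ ∑ k, ev k * inner ℝ (b k) (WithLp.toLp 2 fun _ => (1 : ℝ)) ^ 2 := by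
      rw [Finset.mul_sum]
      gcongr with k
      exact eigAsc_mono _ (Fin.le_def.mpr (by simp))
    rw [← h1, h2, G.lapMatrix_mulVec_const_eq_zero, dotProduct_zero] at h3
    have h4 : (0 : ℝ) < (fun _ : Fin N => (1 : ℝ)) ⬝ᵥ (fun _ => (1 : ℝ)) := by
      simp [dotProduct, hN0]
    by_contra hcon
    push Not at hcon
    nlinarith
  · have h1 := dotProduct_lapMatrix_mulVec G (b ⟨0, hN0⟩).ofLp
    rw [hb, dotProduct_smul, smul_eq_mul, dotProduct_eq_inner] at h1
    have h2 : inner ℝ (WithLp.toLp 2 (b ⟨0, hN0⟩).ofLp) (WithLp.toLp 2 (b ⟨0, hN0⟩).ofLp)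
        = (1 : ℝ) := by
      rw [WithLp.toLp_ofLp, real_inner_self_eq_norm_sq, b.norm_eq_one]; norm_num
    rw [h2, mul_one] at h1
    rw [h1]
    exact div_nonneg (Finset.sum_nonneg fun i _ => Finset.sum_nonneg fun j _ => by
      split_ifs <;> positivity) (by norm_num)

/-- By connectivity the eigenvector of index 0 is constant, hence orthogonal to v; all other
eigenvalues are at least λ₂. -/
theorem lam2_mul_le_dotProduct_lapMatrix_mulVec (hN : 2 ≤ N) (hG : G.Connected) {v : Fin N → ℝ}
    (hv : ∑ i, v i = 0) : lam2 hN G * (v ⬝ᵥ v) ≤ v ⬝ᵥ G.lapMatrix ℝ *ᵥ v := by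
  obtain ⟨b, hb⟩ := exists_eigenbasis_eigAsc (G.isHermitian_lapMatrix (R := ℝ))
  rw [dotProduct_mulVec_eq_sum_eigAsc _ hb, ← sum_inner_sq_eigenbasis b, Finset.mul_sum]
  refine Finset.sum_le_sum fun k _ => ?_
  rcases Nat.eq_zero_or_pos k.val with hk | hk
  · have hk0 : k = ⟨0, by omega⟩ := Fin.ext hk
    have hker : G.lapMatrix ℝ *ᵥ (b k).ofLp = 0 := by
      rw [hb, hk0, eigAsc_lapMatrix_zero hN, zero_smul]
    have h0 : inner ℝ (b k) (WithLp.toLp 2 v) = 0 := by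
      rw [← WithLp.toLp_ofLp 2 (b k), ← dotProduct_eq_inner]
      have hc := fun i => eq_of_lapMatrix_mulVec_eq_zero hG hker i k
      simp only [dotProduct, hc, ← Finset.mul_sum, hv, mul_zero]
    simp [h0]
  · gcongr
    exact eigAsc_mono _ (Fin.le_def.mpr hk)

/-- Otherwise two orthonormal eigenvectors lie in the kernel, so both are constant, and nonzero
constant vectors are not orthogonal. -/
theorem lam2_pos (hN : 2 ≤ N) (hG : G.Connected) : 0 < lam2 hN G := by
  obtain ⟨b, hb⟩ := exists_eigenbasis_eigAsc (G.isHermitian_lapMatrix (R := ℝ))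
  have h0 := eigAsc_lapMatrix_zero (G := G) hN
  have hle : 0 ≤ lam2 hN G := h0 ▸ eigAsc_mono _ (Fin.le_def.mpr (by simp))
  refine hle.lt_of_ne fun h1 => ?_
  set k0 : Fin N := ⟨0, by omega⟩
  set k1 : Fin N := ⟨1, by omega⟩
  have hker0 : G.lapMatrix ℝ *ᵥ (b k0).ofLp = 0 := by rw [hb, h0, zero_smul]
  have hker1 : G.lapMatrix ℝ *ᵥ (b k1).ofLp = 0 := by
    rw [hb, show eigAsc _ k1 = 0 from h1.symm, zero_smul]
  have hc0 := fun i => eq_of_lapMatrix_mulVec_eq_zero hG hker0 i k0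
  have hc1 := fun i => eq_of_lapMatrix_mulVec_eq_zero hG hker1 i k0
  have horth : inner ℝ (b k0) (b k1) = (0 : ℝ) := b.orthonormal.2 (by simp [k0, k1])
  have hn0 : inner ℝ (b k0) (b k0) = (1 : ℝ) := by
    rw [real_inner_self_eq_norm_sq, b.norm_eq_one]; norm_num
  have hn1 : inner ℝ (b k1) (b k1) = (1 : ℝ) := by
    rw [real_inner_self_eq_norm_sq, b.norm_eq_one]; norm_num
  simp only [PiLp.inner_apply, hc0, hc1, Finset.sum_const, Finset.card_univ, Fintype.card_fin,
    RCLike.inner_apply, conj_trivial, nsmul_eq_mul] at horth hn0 hn1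
  have : (1 : ℝ) * 1 = 0 := by
    rw [← hn0]
    nth_rewrite 2 [← hn1.trans hn0.symm]
    linear_combination (N : ℝ) * (b k0).ofLp k0 * (b k1).ofLp k0 * horth
  norm_num at this

theorem lam2_le_lamMax (hN : 2 ≤ N) : lam2 hN G ≤ lamMax hN G :=
  eigAsc_mono _ (Fin.le_def.mpr (by simp; omega))

theorem dotProduct_lapMatrix_mulVec_le_maxDegree (v : Fin N → ℝ) :
    v ⬝ᵥ G.lapMatrix ℝ *ᵥ v ≤ 2 * G.maxDegree * (v ⬝ᵥ v) := by
  rw [dotProduct_lapMatrix_mulVec]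
  have h1 : ∑ i, ∑ j, (if G.Adj i j then (v i - v j) ^ 2 else 0)
      ≤ ∑ i, ∑ j, ((if G.Adj i j then 2 * v i ^ 2 else 0) +
        (if G.Adj j i then 2 * v j ^ 2 else 0)) := by
    gcongr with i _ j _
    by_cases h : G.Adj i j
    · simp only [h, h.symm, if_true]
      nlinarith [sq_nonneg (v i + v j)]
    · have h' : ¬ G.Adj j i := fun h' => h h'.symm
      simp [h, h']
  have h2 : ∑ i, ∑ j, (if G.Adj i j then 2 * v i ^ 2 else 0) ≤ 2 * G.maxDegree * (v ⬝ᵥ v) := by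
    simp only [dotProduct, Finset.mul_sum]
    refine Finset.sum_le_sum fun i _ => ?_
    rw [← Finset.sum_filter, Finset.sum_const, ← G.neighborFinset_eq_filter,
      G.card_neighborFinset_eq_degree, nsmul_eq_mul]
    have : (G.degree i : ℝ) ≤ G.maxDegree := by exact_mod_cast G.degree_le_maxDegree i
    nlinarith [sq_nonneg (v i)]
  simp only [Finset.sum_add_distrib] at h1
  rw [Finset.sum_comm (f := fun i j => if G.Adj j i then 2 * v j ^ 2 else 0)] at h1
  linarith

theorem lamMax_le_two_mul_maxDegree (hN : 2 ≤ N) : lamMax hN G ≤ 2 * G.maxDegree := by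
  obtain ⟨b, hb⟩ := exists_eigenbasis_eigAsc (G.isHermitian_lapMatrix (R := ℝ))
  have h := dotProduct_lapMatrix_mulVec_le_maxDegree (G := G) (b ⟨N - 1, by omega⟩).ofLp
  rw [hb, dotProduct_smul, smul_eq_mul, dotProduct_eq_inner, WithLp.toLp_ofLp,
    real_inner_self_eq_norm_sq, b.norm_eq_one] at h
  simpa [lamMax] using h

/-- If the nonzero Laplacian eigenvalues coincide, then the graph is complete. -/
theorem eq_top_of_lam2_eq_lamMax (hN : 2 ≤ N) (hG : G.Connected) (h : lam2 hN G = lamMax hN G) :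
    G = ⊤ ∧ lamMax hN G = N := by
  set l := lamMax hN G with hl
  have hl0 : 0 < l := h ▸ lam2_pos hN hG
  have hN0 : (0 : ℝ) < N := by exact_mod_cast (by omega : 0 < N)
  -- The two Rayleigh bounds coincide, so on mean-zero vectors the Laplacian form is l‖v‖². Testing
  -- on e_i - 𝟙/N and e_i - e_j recovers the entries of l(I - 𝟙𝟙ᵀ/N). The off-diagonal ones are
  -- nonzero, hence equal to -1, which forces l = N.
  have hform : ∀ v : Fin N → ℝ, ∑ i, v i = 0 → v ⬝ᵥ G.lapMatrix ℝ *ᵥ v = l * (v ⬝ᵥ v) :=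
    fun v hv => le_antisymm (dotProduct_lapMatrix_mulVec_le_lamMax G hN v)
      (h ▸ lam2_mul_le_dotProduct_lapMatrix_mulVec hN hG hv)
  have hentry : ∀ i j, Pi.single i (1 : ℝ) ⬝ᵥ G.lapMatrix ℝ *ᵥ Pi.single j 1
      = G.lapMatrix ℝ i j := fun i j => by simp
  have hone : G.lapMatrix ℝ *ᵥ (fun _ => (1 : ℝ)) = 0 := G.lapMatrix_mulVec_const_eq_zero
  have hsymm : ∀ v w : Fin N → ℝ, v ⬝ᵥ G.lapMatrix ℝ *ᵥ w = w ⬝ᵥ G.lapMatrix ℝ *ᵥ v := by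
    intro v w
    rw [dotProduct_mulVec, ← mulVec_transpose, (G.isSymm_lapMatrix (R := ℝ)).eq, dotProduct_comm]
  have hdiag : ∀ i, G.lapMatrix ℝ i i = l * (1 - 1 / N) := by
    intro i
    have h1 := hform (Pi.single i (1 : ℝ) - (1 / N : ℝ) • fun _ => (1 : ℝ)) (by
      simp [Finset.sum_sub_distrib, hN0.ne'])
    simp only [mulVec_sub, mulVec_smul, hone, smul_zero, sub_zero, sub_dotProduct, hentry,
      smul_dotProduct, hsymm (fun _ => (1 : ℝ)), dotProduct_zero, dotProduct_sub,
      dotProduct_smul] at h1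
    rw [h1]
    simp only [single_dotProduct, dotProduct_single]
    simp [dotProduct, hN0.ne']
  have hoff : ∀ i j, i ≠ j → G.lapMatrix ℝ i j = - (l / N) := by
    intro i j hij
    have h1 := hform (Pi.single i (1 : ℝ) - Pi.single j (1 : ℝ)) (by
      simp [Finset.sum_sub_distrib])
    simp only [mulVec_sub, sub_dotProduct, dotProduct_sub, hentry, hdiag,
      (G.isSymm_lapMatrix (R := ℝ)).apply i j] at h1
    simp [hij, hij.symm] at h1
    field_simp at h1 ⊢
    linarith
  have hadj : ∀ i j, i ≠ j → G.lapMatrix ℝ i j = if G.Adj i j then -1 else 0 := by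
    intro i j hij
    simp [SimpleGraph.lapMatrix, SimpleGraph.degMatrix, hij, SimpleGraph.adjMatrix_apply]
    split_ifs <;> simp
  have hall : ∀ i j, i ≠ j → G.Adj i j := by
    intro i j hij
    by_contra hc
    have h1 := hoff i j hij
    rw [hadj i j hij, if_neg hc] at h1
    have : 0 < l / N := by positivity
    linarith
  refine ⟨?_, ?_⟩
  · ext i j
    simpa using ⟨fun hij => hij.ne, hall i j⟩
  · have hij : (⟨0, by omega⟩ : Fin N) ≠ ⟨1, by omega⟩ := by simp
    have h1 := hoff _ _ hij
    rw [hadj _ _ hij, if_pos (hall _ _ hij)] at h1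
    field_simp at h1
    linarith

end LaplacianSpectrum

/-! ### Inverses of coercive operators -/

section Coercive

variable {F : Type*} [NormedAddCommGroup F] [InnerProductSpace ℝ F]
  {H : F →L[ℝ] F} {c C : ℝ}

theorem mul_norm_le_norm_apply (hc : ∀ v, c * ‖v‖ ^ 2 ≤ inner ℝ v (H v)) (v : F) :
    c * ‖v‖ ≤ ‖H v‖ := by
  rcases (norm_nonneg v).eq_or_lt with h | h
  · rw [← h, mul_zero]; positivity
  · have h1 := (hc v).trans (real_inner_le_norm v (H v))
    nlinarith

variable [FiniteDimensional ℝ F]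

/-- `ContinuousLinearMap.inverse` is zero on non-invertible maps, so the bounds on the Newton
direction rest on this. In finite dimension injectivity suffices. -/
theorem isInvertible_of_coercive (hc0 : 0 < c) (hc : ∀ v, c * ‖v‖ ^ 2 ≤ inner ℝ v (H v)) :
    H.IsInvertible := by
  have hinj : Function.Injective (H : F →ₗ[ℝ] F) := by
    rw [← LinearMap.ker_eq_bot, LinearMap.ker_eq_bot']
    intro v hv
    have h1 := mul_norm_le_norm_apply hc v
    rw [show H v = 0 from hv, norm_zero] at h1
    exact norm_le_zero_iff.mp (nonpos_of_mul_nonpos_right h1 hc0)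
  exact ⟨(LinearEquiv.ofInjectiveEndo _ hinj).toContinuousLinearEquiv, by ext; rfl⟩

theorem norm_inverse_apply_le (hc0 : 0 < c) (hc : ∀ v, c * ‖v‖ ^ 2 ≤ inner ℝ v (H v)) (v : F) :
    ‖H.inverse v‖ ≤ ‖v‖ / c := by
  have h1 := mul_norm_le_norm_apply hc (H.inverse v)
  rw [(isInvertible_of_coercive hc0 hc).self_apply_inverse] at h1
  rw [le_div_iff₀ hc0]
  linarith

theorem inner_inverse_apply_le (hc0 : 0 < c) (hc : ∀ v, c * ‖v‖ ^ 2 ≤ inner ℝ v (H v)) (v : F) :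
    inner ℝ v (H.inverse v) ≤ ‖v‖ ^ 2 / c :=
  calc inner ℝ v (H.inverse v) ≤ ‖v‖ * ‖H.inverse v‖ := real_inner_le_norm _ _
    _ ≤ ‖v‖ * (‖v‖ / c) := by gcongr; exact norm_inverse_apply_le hc0 hc v
    _ = ‖v‖ ^ 2 / c := by ring

theorem le_inner_inverse_apply (hH : (H : F →ₗ[ℝ] F).IsSymmetric) (hc0 : 0 < c)
    (hc : ∀ v, c * ‖v‖ ^ 2 ≤ inner ℝ v (H v)) (hC0 : 0 < C)
    (hC : ∀ v, inner ℝ v (H v) ≤ C * ‖v‖ ^ 2) (v : F) :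
    ‖v‖ ^ 2 / C ≤ inner ℝ v (H.inverse v) := by
  have h1 := norm_apply_sq_le_of_inner_le hH
    (fun x => (mul_nonneg hc0.le (sq_nonneg ‖x‖)).trans (hc x)) hC0 hC (H.inverse v)
  rw [ContinuousLinearMap.coe_coe, (isInvertible_of_coercive hc0 hc).self_apply_inverse,
    real_inner_comm] at h1
  rw [div_le_iff₀ hC0]
  linarith

theorem isSymmetric_inverse (hH : (H : F →ₗ[ℝ] F).IsSymmetric) (hc0 : 0 < c)
    (hc : ∀ v, c * ‖v‖ ^ 2 ≤ inner ℝ v (H v)) : (H.inverse : F →ₗ[ℝ] F).IsSymmetric := by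
  intro v w
  have hi := isInvertible_of_coercive hc0 hc
  have h1 := hH (H.inverse v) (H.inverse w)
  simp only [ContinuousLinearMap.coe_coe, hi.self_apply_inverse] at h1 ⊢
  exact h1.symm

end Coercive

/-! ### Second-order calculus along segments -/

section Calculus

variable {n : ℕ} {f : E n → ℝ}

theorem contDiff_gradient (hf : ContDiff ℝ 2 f) : ContDiff ℝ 1 (gradient f) :=
  (InnerProductSpace.toDual ℝ (E n)).symm.contDiff.comp (hf.fderiv_right (by norm_num))

theorem hasFDerivAt_gradient (hf : ContDiff ℝ 2 f) (x : E n) :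
    HasFDerivAt (gradient f) (hess f x) x :=
  ((contDiff_gradient hf).differentiable (by norm_num) x).hasFDerivAt

theorem continuous_bregman (hf : ContDiff ℝ 2 f) (y : E n) : Continuous (bregman f y) := by
  have h1 := hf.continuous
  have h2 := (contDiff_gradient hf).continuous
  unfold bregman
  fun_prop

/-- Riesz duality identifies the derivative of the gradient with the second Fréchet derivative,
which is symmetric. -/
theorem hess_isSymmetric (hf : ContDiff ℝ 2 f) (x : E n) :
    (hess f x : E n →ₗ[ℝ] E n).IsSymmetric := by
  have hd : Differentiable ℝ (fderiv ℝ f) :=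
    (hf.fderiv_right (m := 1) (by norm_num)).differentiable (by norm_num)
  have key : ∀ v w, inner ℝ (hess f x v) w = fderiv ℝ (fderiv ℝ f) x v w := by
    intro v w
    have h1 := (hasFDerivAt_gradient hf x).inner ℝ (hasFDerivAt_const w x)
    have h2 := (hd x).hasFDerivAt.clm_apply (hasFDerivAt_const w x)
    simp only [inner_gradient_left] at h1
    simpa using congrArg (fun T => T v) (h1.unique h2)
  intro v w
  have h := second_derivative_symmetric (fun y => (hf.differentiable (by norm_num) y).hasFDerivAt)
    (hd x).hasFDerivAt v w
  simp only [ContinuousLinearMap.coe_coe]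
  rw [key, h, ← key, real_inner_comm]

theorem hasDerivAt_line (x d : E n) (t : ℝ) : HasDerivAt (fun t : ℝ => x + t • d) d t := by
  simpa using ((hasDerivAt_id t).smul_const d).const_add x

theorem hasDerivAt_comp_line (hf : ContDiff ℝ 2 f) (x d : E n) (t : ℝ) :
    HasDerivAt (fun t : ℝ => f (x + t • d)) (inner ℝ (gradient f (x + t • d)) d) t := by
  have h := (hf.differentiable (by norm_num) (x + t • d)).hasFDerivAt.comp_hasDerivAt t
    (hasDerivAt_line x d t)
  rwa [← inner_gradient_left] at h

theorem hasDerivAt_gradient_comp_line (hf : ContDiff ℝ 2 f) (x d : E n) (t : ℝ) :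
    HasDerivAt (fun t : ℝ => gradient f (x + t • d)) (hess f (x + t • d) d) t := by
  have h := (hasFDerivAt_gradient hf (x + t • d)).comp_hasDerivAt t (hasDerivAt_line x d t)
  exact h

theorem hasDerivAt_inner_gradient_comp_line (hf : ContDiff ℝ 2 f) (x d : E n) (t : ℝ) :
    HasDerivAt (fun t : ℝ => inner ℝ (gradient f (x + t • d)) d)
      (inner ℝ d (hess f (x + t • d) d)) t := by
  have h := (hasDerivAt_gradient_comp_line hf x d t).inner ℝ (hasDerivAt_const t d)
  simpa [real_inner_comm] using h

theorem exists_inner_gradient_sub_eq (hf : ContDiff ℝ 2 f) (x y : E n) :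
    ∃ z ∈ segment ℝ x y,
      inner ℝ (gradient f y - gradient f x) (y - x) = inner ℝ (y - x) (hess f z (y - x)) := by
  have hd := hasDerivAt_inner_gradient_comp_line hf x (y - x)
  obtain ⟨t, ht, h⟩ := exists_hasDerivAt_eq_slope _ _ (zero_lt_one' ℝ)
    (fun t _ => (hd t).continuousAt.continuousWithinAt) (fun t _ => hd t)
  refine ⟨x + t • (y - x), ?_, ?_⟩
  · rw [segment_eq_image']
    exact ⟨t, ⟨ht.1.le, ht.2.le⟩, rfl⟩
  · rw [h]
    simp [inner_sub_left]

/-- Taylor's formula of second order with the Lagrange remainder. -/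
theorem exists_bregman_eq (hf : ContDiff ℝ 2 f) (x y : E n) :
    ∃ z ∈ segment ℝ x y, bregman f y x = 1 / 2 * inner ℝ (y - x) (hess f z (y - x)) := by
  set d := y - x with hd
  set k := bregman f y x with hk
  set s := inner ℝ (gradient f x) d with hs
  have h0 := hasDerivAt_comp_line hf x d
  have h1 := hasDerivAt_inner_gradient_comp_line hf x d
  -- The value k makes this function take equal values at 0 and 1, while s makes its derivative
  -- vanish at 0. Rolle's theorem then applies twice.
  have hg : ∀ t : ℝ, HasDerivAt (fun t : ℝ => f (x + t • d) - t * s - k * t ^ 2)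
      (inner ℝ (gradient f (x + t • d)) d - s - k * (2 * t)) t := by
    intro t
    exact (((h0 t).sub ((hasDerivAt_id t).mul_const s)).sub
      (((hasDerivAt_id t).pow 2).const_mul k)).congr_deriv (by simp)
  have hg' : ∀ t : ℝ, HasDerivAt
      (fun t : ℝ => inner ℝ (gradient f (x + t • d)) d - s - k * (2 * t))
      (inner ℝ d (hess f (x + t • d) d) - k * 2) t := by
    intro t
    exact (((h1 t).sub_const s).sub
      (((hasDerivAt_id t).const_mul 2).const_mul k)).congr_deriv (by simp)
  obtain ⟨u, hu, hu0⟩ := exists_hasDerivAt_eq_zero (zero_lt_one' ℝ)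
    (fun t _ => (hg t).continuousAt.continuousWithinAt)
    (by simp [hk, hs, bregman, hd]) (fun t _ => hg t)
  obtain ⟨t, ht, ht0⟩ := exists_hasDerivAt_eq_zero hu.1
    (fun t _ => (hg' t).continuousAt.continuousWithinAt)
    (by simp only [hu0]; simp [hs]) (fun t _ => hg' t)
  refine ⟨x + t • d, ?_, by linarith⟩
  rw [segment_eq_image']
  exact ⟨t, ⟨ht.1.le, (ht.2.trans hu.2).le⟩, rfl⟩

variable {S : Set (E n)} {c C L : ℝ} {x y : E n}

theorem HessLowerBound.le_bregman (h : HessLowerBound f S c) (hf : ContDiff ℝ 2 f)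
    (hS : Convex ℝ S) (hx : x ∈ S) (hy : y ∈ S) : c / 2 * ‖y - x‖ ^ 2 ≤ bregman f y x := by
  obtain ⟨z, hz, hz'⟩ := exists_bregman_eq hf x y
  have := h z (hS.segment_subset hx hy hz) (y - x)
  linarith

theorem HessUpperBound.bregman_le (h : HessUpperBound f S C) (hf : ContDiff ℝ 2 f)
    (hS : Convex ℝ S) (hx : x ∈ S) (hy : y ∈ S) : bregman f y x ≤ C / 2 * ‖y - x‖ ^ 2 := by
  obtain ⟨z, hz, hz'⟩ := exists_bregman_eq hf x y
  have := h z (hS.segment_subset hx hy hz) (y - x)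
  linarith

theorem HessLowerBound.le_inner_gradient_sub (h : HessLowerBound f S c) (hf : ContDiff ℝ 2 f)
    (hS : Convex ℝ S) (hx : x ∈ S) (hy : y ∈ S) :
    c * ‖y - x‖ ^ 2 ≤ inner ℝ (gradient f y - gradient f x) (y - x) := by
  obtain ⟨z, hz, hz'⟩ := exists_inner_gradient_sub_eq hf x y
  have := h z (hS.segment_subset hx hy hz) (y - x)
  linarith

/-- The remainder is vector-valued, so instead of a mean value equality its norm is compared with
the majorant (L/2)‖d‖²t², whose derivative dominates. -/
theorem HessLipschitz.norm_gradient_remainder_le (h : HessLipschitz f S L) (hf : ContDiff ℝ 2 f)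
    (hS : Convex ℝ S) (hx : x ∈ S) (hy : y ∈ S) :
    ‖gradient f y - gradient f x - hess f x (y - x)‖ ≤ L / 2 * ‖y - x‖ ^ 2 := by
  set d := y - x with hd
  have hg : ∀ t : ℝ, HasDerivAt (fun t : ℝ => gradient f (x + t • d) - gradient f x
      - t • hess f x d) (hess f (x + t • d) d - hess f x d) t := by
    intro t
    exact (((hasDerivAt_gradient_comp_line hf x d t).sub_const (gradient f x)).sub
      ((hasDerivAt_id t).smul_const (hess f x d))).congr_deriv (by simp)
  have hB : ∀ t : ℝ, HasDerivAt (fun t : ℝ => L / 2 * ‖d‖ ^ 2 * t ^ 2) (L * ‖d‖ ^ 2 * t) t := by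
    intro t
    refine (((hasDerivAt_id t).pow 2).const_mul (L / 2 * ‖d‖ ^ 2)).congr_deriv ?_
    simp
    ring
  have key := image_norm_le_of_norm_deriv_right_le_deriv_boundary (a := 0) (b := 1)
    (fun t _ => (hg t).continuousAt.continuousWithinAt)
    (fun t _ => (hg t).hasDerivWithinAt) (by simp) hB (fun t ht => by
      have hm : x + t • d ∈ S := hS.segment_subset hx hy (by
        rw [segment_eq_image']; exact ⟨t, ⟨ht.1, ht.2.le⟩, rfl⟩)
      calc ‖hess f (x + t • d) d - hess f x d‖ = ‖(hess f (x + t • d) - hess f x) d‖ := by simp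
        _ ≤ ‖hess f (x + t • d) - hess f x‖ * ‖d‖ := ContinuousLinearMap.le_opNorm _ _
        _ ≤ L * ‖x + t • d - x‖ * ‖d‖ := by gcongr; exact h _ hm _ hx
        _ = L * ‖d‖ ^ 2 * t := by
          rw [add_sub_cancel_left, norm_smul, Real.norm_of_nonneg ht.1]; ring)
    (Set.right_mem_Icc.mpr zero_le_one)
  simpa [hd] using key

theorem bregman_nonneg (hf : ObjectiveAssumption f) (x y : E n) : 0 ≤ bregman f y x := by
  obtain ⟨c, hc, h⟩ := hf.stronglyConvex (segment ℝ x y) (convex_segment x y) (by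
    rw [segment_eq_image']
    exact isCompact_Icc.image (by fun_prop))
  exact (by positivity : (0 : ℝ) ≤ c / 2 * ‖y - x‖ ^ 2).trans
    (h.le_bregman hf.contDiff (convex_segment x y) (left_mem_segment ℝ x y)
      (right_mem_segment ℝ x y))

theorem gradient_eq_zero_of_isMinOn (h : IsMinOn f Set.univ x) : gradient f x = 0 := by
  have h1 : fderiv ℝ f x = 0 := (h.isLocalMin Filter.univ_mem).fderiv_eq_zero
  rw [gradient, h1, map_zero]

end Calculus

theorem inner_stack {N n : ℕ} (x y : Stack N n) : inner ℝ x y = ∑ i, inner ℝ (x i) (y i) :=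
  PiLp.inner_apply x y

theorem norm_stack_sq {N n : ℕ} (x : Stack N n) : ‖x‖ ^ 2 = ∑ i, ‖x i‖ ^ 2 :=
  PiLp.norm_sq_eq_of_L2 _ x

/-! ### The weighted Laplacian on stacked vectors -/

section WeightedLaplacian

variable {N n : ℕ} (G : SimpleGraph (Fin N)) [DecidableRel G.Adj] (α : Sym2 (Fin N) → ℝ)

theorem sum_neighborFinset_comm {M : Type*} [AddCommMonoid M] (F : Fin N → Fin N → M) :
    ∑ i, ∑ j ∈ G.neighborFinset i, F i j = ∑ i, ∑ j ∈ G.neighborFinset i, F j i :=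
  Finset.sum_comm' (by simp [G.adj_comm])

/-- The Laplacian of `G` with weights `α`, acting on stacked vectors. -/
def wlap : Stack N n →ₗ[ℝ] Stack N n where
  toFun x := WithLp.toLp 2 fun i => ∑ j ∈ G.neighborFinset i, α s(i, j) • (x i - x j)
  map_add' x y := by
    ext1 i
    simp only [PiLp.add_apply, ← Finset.sum_add_distrib, ← smul_add]
    exact Finset.sum_congr rfl fun j _ => by congr 1; abel
  map_smul' c x := by
    ext1 i
    simp only [PiLp.smul_apply, Finset.smul_sum, RingHom.id_apply]
    exact Finset.sum_congr rfl fun j _ => by rw [← smul_sub, smul_comm]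

theorem wlap_apply (x : Stack N n) (i : Fin N) :
    wlap G α x i = ∑ j ∈ G.neighborFinset i, α s(i, j) • (x i - x j) := rfl

/-- Average the sum with its copy in which the endpoints of every edge are exchanged. -/
theorem inner_wlap (x y : Stack N n) :
    inner ℝ y (wlap G α x) =
      1 / 2 * ∑ i, ∑ j ∈ G.neighborFinset i, α s(i, j) * inner ℝ (y i - y j) (x i - x j) := by
  have h1 : inner ℝ y (wlap G α x) =
      ∑ i, ∑ j ∈ G.neighborFinset i, α s(i, j) * inner ℝ (y i) (x i - x j) := by
    simp only [inner_stack, wlap_apply, inner_sum, real_inner_smul_right]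
  have h2 := h1
  rw [sum_neighborFinset_comm G fun i j => α s(i, j) * inner ℝ (y i) (x i - x j)] at h2
  have h3 : ∑ i, ∑ j ∈ G.neighborFinset i, α s(i, j) * inner ℝ (y i - y j) (x i - x j)
      = ∑ i, ∑ j ∈ G.neighborFinset i, α s(i, j) * inner ℝ (y i) (x i - x j)
        + ∑ i, ∑ j ∈ G.neighborFinset i, α s(j, i) * inner ℝ (y j) (x j - x i) := by
    simp only [← Finset.sum_add_distrib]
    refine Finset.sum_congr rfl fun i _ => Finset.sum_congr rfl fun j _ => ?_
    rw [Sym2.eq_swap (a := j), ← neg_sub (x i) (x j), inner_neg_right, inner_sub_left]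
    ring
  rw [h3, ← h1, ← h2]
  ring

theorem wlap_isSymmetric : (wlap G α : Stack N n →ₗ[ℝ] Stack N n).IsSymmetric := by
  intro x y
  rw [real_inner_comm, inner_wlap, inner_wlap]
  simp only [real_inner_comm]

theorem inner_wlap_self (x : Stack N n) :
    inner ℝ x (wlap G α x) =
      1 / 2 * ∑ i, ∑ j ∈ G.neighborFinset i, α s(i, j) * ‖x i - x j‖ ^ 2 := by
  simp only [inner_wlap, real_inner_self_eq_norm_sq]

theorem wlap_consensus (z : E n) : wlap G α (consensus N z) = 0 := by
  ext1 i
  simp [wlap_apply, consensus]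

theorem inner_consensus_wlap (z : E n) (x : Stack N n) :
    inner ℝ (consensus N z) (wlap G α x) = 0 := by
  rw [← wlap_isSymmetric, wlap_consensus, inner_zero_left]

/-- The range is orthogonal to consensus vectors. This is what cancels the first-order change of the
summed gradients. -/
theorem sum_wlap_apply (x : Stack N n) : ∑ i, wlap G α x i = 0 := by
  refine ext_inner_left ℝ fun v => ?_
  rw [inner_zero_right, ← inner_consensus_wlap G α v x, inner_stack, inner_sum]
  rfl

/-- The n coordinates decouple, so the scalar spectral bounds carry over to stacked vectors. -/
theorem sum_norm_sub_sq_eq_sum_lapMatrix (x : Stack N n) :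
    1 / 2 * ∑ i, ∑ j ∈ G.neighborFinset i, ‖x i - x j‖ ^ 2 =
      ∑ c, (fun i => x i c) ⬝ᵥ Matrix.mulVec (G.lapMatrix ℝ) (fun i => x i c) := by
  simp only [dotProduct_lapMatrix_mulVec, G.neighborFinset_eq_filter, Finset.sum_filter]
  rw [← Finset.sum_div, one_div, inv_mul_eq_div]
  congr 1
  symm
  rw [Finset.sum_comm]
  refine Finset.sum_congr rfl fun i _ => ?_
  rw [Finset.sum_comm]
  refine Finset.sum_congr rfl fun j _ => ?_
  split_ifs
  · simp [EuclideanSpace.real_norm_sq_eq]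
  · simp

theorem norm_sq_eq_sum_dotProduct (x : Stack N n) :
    ‖x‖ ^ 2 = ∑ c, (fun i => x i c) ⬝ᵥ (fun i => x i c) := by
  simp only [norm_stack_sq, EuclideanSpace.real_norm_sq_eq, dotProduct]
  rw [Finset.sum_comm]
  simp only [sq]

variable {G α}

theorem weighted_sum_le {a : ℝ} (h : ∀ e ∈ G.edgeSet, α e ≤ a) (x : Stack N n) :
    inner ℝ x (wlap G α x) ≤ a * (1 / 2 * ∑ i, ∑ j ∈ G.neighborFinset i, ‖x i - x j‖ ^ 2) := by
  rw [inner_wlap_self, mul_left_comm, Finset.mul_sum (a := a)]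
  simp only [Finset.mul_sum (a := a)]
  gcongr with i _ j hj
  exact h _ (by simpa using hj)

theorem le_weighted_sum {a : ℝ} (h : ∀ e ∈ G.edgeSet, a ≤ α e) (x : Stack N n) :
    a * (1 / 2 * ∑ i, ∑ j ∈ G.neighborFinset i, ‖x i - x j‖ ^ 2) ≤ inner ℝ x (wlap G α x) := by
  rw [inner_wlap_self, mul_left_comm, Finset.mul_sum (a := a)]
  simp only [Finset.mul_sum (a := a)]
  gcongr with i _ j hj
  exact h _ (by simpa using hj)

theorem inner_wlap_self_nonneg (h : ∀ e ∈ G.edgeSet, 0 < α e) (x : Stack N n) :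
    0 ≤ inner ℝ x (wlap G α x) := by
  simpa using le_weighted_sum (fun e he => (h e he).le) x

theorem inner_wlap_self_le (hN : 2 ≤ N) {a : ℝ} (ha : 0 ≤ a) (h : ∀ e ∈ G.edgeSet, α e ≤ a)
    (x : Stack N n) : inner ℝ x (wlap G α x) ≤ a * lamMax hN G * ‖x‖ ^ 2 := by
  refine (weighted_sum_le h x).trans ?_
  rw [mul_assoc, sum_norm_sub_sq_eq_sum_lapMatrix, norm_sq_eq_sum_dotProduct,
    Finset.mul_sum (a := lamMax hN G)]
  gcongr
  exact dotProduct_lapMatrix_mulVec_le_lamMax G hN _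

theorem le_inner_wlap_self (hN : 2 ≤ N) (hG : G.Connected) {a : ℝ} (ha : 0 ≤ a)
    (h : ∀ e ∈ G.edgeSet, a ≤ α e) {x : Stack N n} (hx : ∑ i, x i = 0) :
    a * lam2 hN G * ‖x‖ ^ 2 ≤ inner ℝ x (wlap G α x) := by
  refine le_trans ?_ (le_weighted_sum h x)
  rw [mul_assoc, sum_norm_sub_sq_eq_sum_lapMatrix, norm_sq_eq_sum_dotProduct,
    Finset.mul_sum (a := lam2 hN G)]
  gcongr with c
  refine lam2_mul_le_dotProduct_lapMatrix_mulVec hN hG ?_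
  simpa using congrArg (fun v : E n => v c) hx

theorem norm_wlap_sq_le (hN : 2 ≤ N) (hG : G.Connected) {a : ℝ} (ha : 0 < a)
    (hpos : ∀ e ∈ G.edgeSet, 0 < α e) (h : ∀ e ∈ G.edgeSet, α e ≤ a) (x : Stack N n) :
    ‖wlap G α x‖ ^ 2 ≤ a * lamMax hN G * inner ℝ x (wlap G α x) :=
  norm_apply_sq_le_of_inner_le (wlap_isSymmetric G α) (inner_wlap_self_nonneg hpos)
    (mul_pos ha ((lam2_pos hN hG).trans_le (lam2_le_lamMax hN))) (inner_wlap_self_le hN ha.le h) x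

theorem le_norm_wlap_sq (hN : 2 ≤ N) (hG : G.Connected) {a : ℝ} (ha : 0 < a)
    (h : ∀ e ∈ G.edgeSet, a ≤ α e) (x : Stack N n) :
    a * lam2 hN G * inner ℝ x (wlap G α x) ≤ ‖wlap G α x‖ ^ 2 := by
  have hN0 : (N : ℝ) ≠ 0 := by exact_mod_cast (by omega : N ≠ 0)
  -- Removing the mean changes neither W x nor Q, and gives m‖p‖² ≤ Q ≤ ‖p‖‖W x‖; eliminating ‖p‖
  -- leaves mQ ≤ ‖W x‖².
  set p : Stack N n := x - consensus N ((N : ℝ)⁻¹ • ∑ i, x i) with hp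
  have hsum : ∑ i, p i = 0 := by
    simp only [hp, PiLp.sub_apply, consensus, Finset.sum_sub_distrib, Finset.sum_const,
      Finset.card_univ, Fintype.card_fin]
    rw [← Nat.cast_smul_eq_nsmul ℝ, smul_smul, mul_inv_cancel₀ hN0, one_smul, sub_self]
  have hw : wlap G α p = wlap G α x := by rw [hp, map_sub, wlap_consensus, sub_zero]
  have hQ : inner ℝ p (wlap G α p) = inner ℝ x (wlap G α x) := by
    rw [hw, hp, inner_sub_left, inner_consensus_wlap, sub_zero]
  have h1 := le_inner_wlap_self hN hG ha.le h hsum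
  have h2 := real_inner_le_norm p (wlap G α p)
  rw [hQ] at h1 h2
  rw [hw] at h2
  have hm : 0 < a * lam2 hN G := mul_pos ha (lam2_pos hN hG)
  set m := a * lam2 hN G
  set Q := inner ℝ x (wlap G α x)
  have hQ0 : 0 ≤ Q := (by positivity : 0 ≤ m * ‖p‖ ^ 2).trans h1
  rcases hQ0.eq_or_lt with h0 | h0
  · rw [← h0, mul_zero]; positivity
  · have h3 : Q ^ 2 ≤ ‖p‖ ^ 2 * ‖wlap G α x‖ ^ 2 := by
      rw [← mul_pow]; gcongr
    have h4 : Q * (m * Q) ≤ Q * ‖wlap G α x‖ ^ 2 := by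
      calc Q * (m * Q) = m * Q ^ 2 := by ring
        _ ≤ m * (‖p‖ ^ 2 * ‖wlap G α x‖ ^ 2) := by gcongr
        _ = (m * ‖p‖ ^ 2) * ‖wlap G α x‖ ^ 2 := by ring
        _ ≤ Q * ‖wlap G α x‖ ^ 2 := by gcongr
    exact le_of_mul_le_mul_left h4 h0

theorem eq_consensus_of_inner_wlap_self_eq_zero (hG : G.Connected)
    (hpos : ∀ e ∈ G.edgeSet, 0 < α e) {x : Stack N n} (hx : inner ℝ x (wlap G α x) = 0)
    (i j : Fin N) : x i = x j := by
  have hnn : ∀ i, ∀ j ∈ G.neighborFinset i, 0 ≤ α s(i, j) * ‖x i - x j‖ ^ 2 := fun i j hj =>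
    mul_nonneg (hpos _ (by simpa using hj)).le (by positivity)
  rw [inner_wlap_self, mul_eq_zero, Finset.sum_eq_zero_iff_of_nonneg
    (fun i _ => Finset.sum_nonneg (hnn i))] at hx
  have hadj : ∀ i j, G.Adj i j → x i = x j := by
    intro i j hij
    have h1 := (hx.resolve_left (by norm_num)) i (Finset.mem_univ i)
    rw [Finset.sum_eq_zero_iff_of_nonneg (hnn i)] at h1
    have h2 := h1 j (by simpa using hij)
    have h3 : ‖x i - x j‖ ^ 2 = 0 := (mul_eq_zero.mp h2).resolve_left (hpos s(i, j) hij).ne'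
    simpa [sub_eq_zero] using h3
  obtain ⟨w⟩ := hG.preconnected i j
  induction w with
  | nil => rfl
  | cons h _ ih => exact (hadj _ _ h).trans ih

end WeightedLaplacian

/-! ### Block-diagonal operators -/

section BlockOperators

variable {N n : ℕ}

/-- The block-diagonal operator with blocks `A i`. -/
def blockDiag (A : Fin N → E n →L[ℝ] E n) : Stack N n →ₗ[ℝ] Stack N n where
  toFun v := WithLp.toLp 2 fun i => A i (v i)
  map_add' x y := by ext1 i; simp
  map_smul' c x := by ext1 i; simp

theorem blockDiag_apply (A : Fin N → E n →L[ℝ] E n) (v : Stack N n) (i : Fin N) :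
    blockDiag A v i = A i (v i) := rfl

theorem blockDiag_isSymmetric {A : Fin N → E n →L[ℝ] E n}
    (hA : ∀ i, (A i : E n →ₗ[ℝ] E n).IsSymmetric) : (blockDiag A).IsSymmetric := by
  intro v w
  simp only [inner_stack, blockDiag_apply]
  exact Finset.sum_congr rfl fun i _ => hA i _ _

theorem inner_blockDiag_le {A : Fin N → E n →L[ℝ] E n} {c : ℝ}
    (h : ∀ i v, inner ℝ v (A i v) ≤ ‖v‖ ^ 2 / c) (v : Stack N n) :
    inner ℝ v (blockDiag A v) ≤ ‖v‖ ^ 2 / c := by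
  rw [inner_stack, norm_stack_sq, Finset.sum_div]
  exact Finset.sum_le_sum fun i _ => h i _

theorem le_inner_blockDiag {A : Fin N → E n →L[ℝ] E n} {c : ℝ}
    (h : ∀ i v, ‖v‖ ^ 2 / c ≤ inner ℝ v (A i v)) (v : Stack N n) :
    ‖v‖ ^ 2 / c ≤ inner ℝ v (blockDiag A v) := by
  rw [inner_stack, norm_stack_sq, Finset.sum_div]
  exact Finset.sum_le_sum fun i _ => h i _

theorem norm_blockDiag_le {A : Fin N → E n →L[ℝ] E n} {c : ℝ} (hc : 0 < c)
    (h : ∀ i v, ‖A i v‖ ≤ ‖v‖ / c) (v : Stack N n) : ‖blockDiag A v‖ ≤ ‖v‖ / c := by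
  have h1 : ‖blockDiag A v‖ ^ 2 ≤ (‖v‖ / c) ^ 2 := by
    rw [div_pow, norm_stack_sq, norm_stack_sq, Finset.sum_div]
    refine Finset.sum_le_sum fun i _ => ?_
    rw [← div_pow, blockDiag_apply]
    gcongr
    exact h i _
  exact le_of_sq_le_sq h1 (by positivity)

end BlockOperators

/-! ### One update as a preconditioned Richardson step -/

section Step

variable {N n : ℕ} {G : SimpleGraph (Fin N)} [DecidableRel G.Adj] {α : Sym2 (Fin N) → ℝ}
  {f : Fin N → E n → ℝ}

theorem gradient_quadSurrogate (e : Sym2 (Fin N)) (x : E n) :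
    gradient (quadSurrogate N n e) x = x := by
  have h := ((hasFDerivAt_id x).inner ℝ (hasFDerivAt_id x)).const_mul (1 / 2 : ℝ)
  refine ext_inner_right ℝ fun v => ?_
  rw [inner_gradient_left]
  have h' : fderiv ℝ (quadSurrogate N n e) x = _ := h.fderiv
  rw [h']
  simp [real_inner_comm]
  ring

variable (G α f) in
theorem step_quadSurrogate (x : Stack N n) :
    step G f (quadSurrogate N n) α x =
      x - blockDiag (fun i => (hess (f i) (x i)).inverse) (wlap G α x) := by
  ext1 i
  simp only [step, gradient_quadSurrogate, PiLp.sub_apply, blockDiag_apply, wlap_apply]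
  rw [sub_eq_add_neg, ← map_neg, ← Finset.sum_neg_distrib]
  simp only [← smul_neg, neg_sub]

/-- The preconditioner is frozen at the current point, so the linear contraction lemma applies to
the nonlinear step. Only Hessian bounds at x are needed, not along the step. -/
theorem energy_step_le (hN : 2 ≤ N) (hG : G.Connected) (hf : ∀ i, ContDiff ℝ 2 (f i))
    {a b c C q : ℝ} (hb : 0 < b) (hαb : ∀ e ∈ G.edgeSet, b ≤ α e) (hαa : ∀ e ∈ G.edgeSet, α e ≤ a)
    (ha : 0 < a) (hc : 0 < c) (hC : 0 < C) (hq0 : 0 ≤ q) (hqa : a * lamMax hN G / c - 1 ≤ q)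
    (hqb : 1 - b * lam2 hN G / C ≤ q) {x : Stack N n}
    (hlow : ∀ i v, c * ‖v‖ ^ 2 ≤ inner ℝ v (hess (f i) (x i) v))
    (hup : ∀ i v, inner ℝ v (hess (f i) (x i) v) ≤ C * ‖v‖ ^ 2) :
    inner ℝ (step G f (quadSurrogate N n) α x) (wlap G α (step G f (quadSurrogate N n) α x)) ≤
      q ^ 2 * inner ℝ x (wlap G α x) := by
  rw [step_quadSurrogate]
  have hpos : ∀ e ∈ G.edgeSet, 0 < α e := fun e he => hb.trans_le (hαb e he)
  refine energy_sub_comp_le (wlap_isSymmetric G α) (blockDiag_isSymmetric fun i =>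
    isSymmetric_inverse (hess_isSymmetric (hf i) (x i)) hc (hlow i)) hq0 (fun y => ?_) x
  have h1 := inner_blockDiag_le (fun i => inner_inverse_apply_le hc (hlow i)) (wlap G α y)
  have h2 := le_inner_blockDiag (fun i => le_inner_inverse_apply (hess_isSymmetric (hf i) (x i))
    hc (hlow i) hC (hup i)) (wlap G α y)
  have h3 := norm_wlap_sq_le hN hG ha hpos hαa y
  have h4 := le_norm_wlap_sq hN hG hb hαb y
  have hQ := inner_wlap_self_nonneg hpos y
  set Q := inner ℝ y (wlap G α y)
  have h5 : ‖wlap G α y‖ ^ 2 / c ≤ (1 + q) * Q :=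
    calc ‖wlap G α y‖ ^ 2 / c ≤ (a * lamMax hN G * Q) / c := by gcongr
      _ = (a * lamMax hN G / c) * Q := by ring
      _ ≤ (1 + q) * Q := by gcongr; linarith
  have h6 : (1 - q) * Q ≤ ‖wlap G α y‖ ^ 2 / C :=
    calc (1 - q) * Q ≤ (b * lam2 hN G / C) * Q := by gcongr; linarith
      _ = (b * lam2 hN G * Q) / C := by ring
      _ ≤ ‖wlap G α y‖ ^ 2 / C := by gcongr
  rw [abs_le]
  constructor <;> linarith

theorem norm_step_sub_le {c : ℝ} (hc : 0 < c) {x : Stack N n}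
    (hlow : ∀ i v, c * ‖v‖ ^ 2 ≤ inner ℝ v (hess (f i) (x i) v)) :
    ‖step G f (quadSurrogate N n) α x - x‖ ≤ ‖wlap G α x‖ / c := by
  rw [step_quadSurrogate, sub_sub_cancel_left, norm_neg]
  exact norm_blockDiag_le hc (fun i => norm_inverse_apply_le hc (hlow i)) _

end Step

theorem le_iSup_neighbor {N : ℕ} {G : SimpleGraph (Fin N)} {α : Sym2 (Fin N) → ℝ}
    {i j : Fin N} (h : G.Adj i j) :
    α s(i, j) ≤ ⨆ j : G.neighborSet i, α s(i, (j : Fin N)) :=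
  le_ciSup (f := fun j : G.neighborSet i => α s(i, (j : Fin N))) (Set.finite_range _).bddAbove
    ⟨j, h⟩

/-! ### Decrease of the Lyapunov function -/

section Lyapunov

variable {N n : ℕ} {G : SimpleGraph (Fin N)} [DecidableRel G.Adj] {α : Sym2 (Fin N) → ℝ}
  {f : Fin N → E n → ℝ} {xs : E n} {x0 x : Stack N n} {θ C L r : Fin N → ℝ}

theorem bregman_sub_bregman_le {g : E n → ℝ} (hg : ContDiff ℝ 2 g) {S : Set (E n)}
    (hS : Convex ℝ S) {c l s : ℝ} (hc : HessUpperBound g S c) (hl : HessLipschitz g S l)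
    (hl0 : 0 ≤ l) {y z p : E n} (hy : y ∈ S) (hz : z ∈ S) (hs : ‖y - p‖ ≤ s) :
    bregman g p z - bregman g p y ≤
      inner ℝ (hess g y (z - y)) (y - p) + (c / 2 + l / 2 * s) * ‖z - y‖ ^ 2 := by
  have h1 := hc.bregman_le hg hS hz hy
  have h2 := hl.norm_gradient_remainder_le hg hS hy hz
  set w := gradient g z - gradient g y - hess g y (z - y) with hw
  -- Three-point identity D(p,z) - D(p,y) = D(y,z) + ⟨∇g(z) - ∇g(y), y - p⟩, with the gradient
  -- increment split into its Hessian part and the Taylor remainder w.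
  have h3 : bregman g p z - bregman g p y
      = bregman g y z + inner ℝ (hess g y (z - y)) (y - p) + inner ℝ w (y - p) := by
    have e : hess g y (z - y) = gradient g z - gradient g y - w := by rw [hw]; abel
    rw [e]
    simp only [bregman, inner_sub_left, inner_sub_right]
    ring
  have h4 : inner ℝ w (y - p) ≤ l / 2 * ‖z - y‖ ^ 2 * s :=
    (real_inner_le_norm _ _).trans (by gcongr)
  rw [norm_sub_rev] at h1
  rw [h3]
  linarith

theorem V_nonneg (hf : ∀ i, ObjectiveAssumption (f i)) (x : Stack N n) : 0 ≤ V f xs x :=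
  Finset.sum_nonneg fun i _ => bregman_nonneg (hf i) _ _

theorem mem_Cset_of_V_le (hf : ∀ i, ObjectiveAssumption (f i)) (h : V f xs x ≤ V f xs x0)
    (i : Fin N) : x i ∈ Cset f xs x0 i :=
  (Finset.single_le_sum (f := fun i => bregman (f i) xs (x i))
    (fun i _ => bregman_nonneg (hf i) _ _) (Finset.mem_univ i)).trans h

theorem optimum_mem_Cset (hf : ∀ i, ObjectiveAssumption (f i)) (i : Fin N) :
    xs ∈ Cset f xs x0 i := by
  simpa [Cset, bregman] using V_nonneg (xs := xs) hf x0

theorem norm_sub_le_of_mem_Cset (hf : ∀ i, ObjectiveAssumption (f i)) {i : Fin N}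
    (hθ : 0 < θ i ∧ HessLowerBound (f i) (convexHull ℝ (Cset f xs x0 i)) (θ i)) {y : E n}
    (hy : y ∈ Cset f xs x0 i) : ‖y - xs‖ ≤ √(2 * V f xs x0 / θ i) := by
  have h1 := hθ.2.le_bregman (hf i).contDiff (convex_convexHull ℝ _)
    (subset_convexHull ℝ _ hy) (subset_convexHull ℝ _ (optimum_mem_Cset hf i))
  have h2 : bregman (f i) xs y ≤ V f xs x0 := hy
  rw [norm_sub_rev]
  apply Real.le_sqrt_of_sq_le
  rw [le_div_iff₀ hθ.1]
  linarith

theorem hess_step_sub (hθ0 : ∀ i, 0 < θ i)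
    (hlow : ∀ i v, θ i * ‖v‖ ^ 2 ≤ inner ℝ v (hess (f i) (x i) v)) (i : Fin N) :
    hess (f i) (x i) (step G f (quadSurrogate N n) α x i - x i) = - wlap G α x i := by
  rw [step_quadSurrogate, PiLp.sub_apply, blockDiag_apply, sub_sub_cancel_left, map_neg,
    (isInvertible_of_coercive (hθ0 i) (hlow i)).self_apply_inverse]

theorem norm_step_sub_apply_le (hθ0 : ∀ i, 0 < θ i)
    (hlow : ∀ i v, θ i * ‖v‖ ^ 2 ≤ inner ℝ v (hess (f i) (x i) v)) (i : Fin N) :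
    ‖step G f (quadSurrogate N n) α x i - x i‖ ≤ ‖wlap G α x i‖ / θ i := by
  rw [step_quadSurrogate, PiLp.sub_apply, blockDiag_apply, sub_sub_cancel_left, norm_neg]
  exact norm_inverse_apply_le (hθ0 i) (hlow i) _

theorem V_step_le_sub_energy (hf : ∀ i, ContDiff ℝ 2 (f i)) (hθ0 : ∀ i, 0 < θ i)
    (hlow : ∀ i v, θ i * ‖v‖ ^ 2 ≤ inner ℝ v (hess (f i) (x i) v)) {S : Fin N → Set (E n)}
    (hS : ∀ i, Convex ℝ (S i)) (hC : ∀ i, HessUpperBound (f i) (S i) (C i))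
    (hL : ∀ i, 0 ≤ L i ∧ HessLipschitz (f i) (S i) (L i)) (hx : ∀ i, x i ∈ S i)
    (hx' : ∀ i, step G f (quadSurrogate N n) α x i ∈ S i) (hr : ∀ i, ‖x i - xs‖ ≤ r i) :
    V f xs (step G f (quadSurrogate N n) α x) ≤ V f xs x - inner ℝ x (wlap G α x) +
      ∑ i, (C i / 2 + L i / 2 * r i) * ‖step G f (quadSurrogate N n) α x i - x i‖ ^ 2 := by
  have h1 := Finset.sum_le_sum fun i (_ : i ∈ Finset.univ) =>
    bregman_sub_bregman_le (hf i) (hS i) (hC i) (hL i).2 (hL i).1 (hx i) (hx' i) (hr i)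
  rw [Finset.sum_sub_distrib, Finset.sum_add_distrib] at h1
  -- The Hessian undoes the preconditioner, so these terms sum to -⟨x - x*, W x⟩, and the consensus
  -- vector x* is invisible to W.
  have h2 : ∑ i, inner ℝ (hess (f i) (x i) (step G f (quadSurrogate N n) α x i - x i)) (x i - xs)
      = - inner ℝ x (wlap G α x) := by
    have h3 : inner ℝ (x - consensus N xs) (wlap G α x) = inner ℝ x (wlap G α x) := by
      rw [inner_sub_left, inner_consensus_wlap, sub_zero]
    rw [← h3, inner_stack, ← Finset.sum_neg_distrib]
    refine Finset.sum_congr rfl fun i _ => ?_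
    rw [hess_step_sub hθ0 hlow, inner_neg_left, real_inner_comm]
    rfl
  rw [h2] at h1
  unfold V
  linarith

theorem degree_pos_of_connected (hN : 2 ≤ N) (hG : G.Connected) (i : Fin N) : 0 < G.degree i := by
  have : Nontrivial (Fin N) := Fin.nontrivial_iff_two_le.mpr hN
  exact hG.preconnected.degree_pos_of_nontrivial i

theorem exists_iSup_neighbor_eq (hN : 2 ≤ N) (hG : G.Connected) (i : Fin N) :
    ∃ j, G.Adj i j ∧ ⨆ j : G.neighborSet i, α s(i, (j : Fin N)) = α s(i, j) := by
  obtain ⟨j, hj⟩ := (G.degree_pos_iff_exists_adj i).mp (degree_pos_of_connected hN hG i)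
  have : Nonempty (G.neighborSet i) := ⟨⟨j, hj⟩⟩
  obtain ⟨k, hk⟩ := exists_eq_ciSup_of_finite (f := fun j : G.neighborSet i => α s(i, (j : Fin N)))
  exact ⟨k, k.2, hk.symm⟩

theorem iSup_neighbor_pos (hN : 2 ≤ N) (hG : G.Connected) (hpos : ∀ e ∈ G.edgeSet, 0 < α e)
    (i : Fin N) : 0 < ⨆ j : G.neighborSet i, α s(i, (j : Fin N)) := by
  obtain ⟨j, hj, h⟩ := exists_iSup_neighbor_eq (α := α) hN hG i
  rw [h]
  exact hpos _ hj

theorem norm_wlap_apply_sq_le (hpos : ∀ e ∈ G.edgeSet, 0 < α e) (x : Stack N n) (i : Fin N) :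
    ‖wlap G α x i‖ ^ 2 ≤ G.degree i * (⨆ j : G.neighborSet i, α s(i, (j : Fin N))) *
      ∑ j ∈ G.neighborFinset i, α s(i, j) * ‖x i - x j‖ ^ 2 := by
  set m := ⨆ j : G.neighborSet i, α s(i, (j : Fin N))
  have hp : ∀ j ∈ G.neighborFinset i, 0 < α s(i, j) := fun j hj => hpos _ (by simpa using hj)
  calc ‖wlap G α x i‖ ^ 2 ≤ (∑ j ∈ G.neighborFinset i, α s(i, j) * ‖x i - x j‖) ^ 2 := by
        gcongr
        rw [wlap_apply]
        refine (norm_sum_le _ _).trans (Finset.sum_le_sum fun j hj => ?_)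
        rw [norm_smul, Real.norm_of_nonneg (hp j hj).le]
    _ ≤ G.degree i * ∑ j ∈ G.neighborFinset i, (α s(i, j) * ‖x i - x j‖) ^ 2 := by
        rw [← G.card_neighborFinset_eq_degree]
        exact sq_sum_le_card_mul_sum_sq
    _ ≤ G.degree i * ∑ j ∈ G.neighborFinset i, m * (α s(i, j) * ‖x i - x j‖ ^ 2) := by
        gcongr with j hj
        have h1 : α s(i, j) ≤ m := le_iSup_neighbor (by simpa using hj)
        have h2 := mul_le_mul_of_nonneg_right h1
          (mul_nonneg (hp j hj).le (sq_nonneg ‖x i - x j‖))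
        calc _ = α s(i, j) * (α s(i, j) * ‖x i - x j‖ ^ 2) := by ring
          _ ≤ _ := h2
    _ = _ := by rw [← Finset.mul_sum, mul_assoc]

/-- Cauchy–Schwarz over the neighbors of each node. The factor 2 in the denominator reflects that Q
counts each edge once, while both of its endpoints use it. -/
theorem sum_norm_step_sub_sq_le_energy (hN : 2 ≤ N) (hG : G.Connected)
    (hpos : ∀ e ∈ G.edgeSet, 0 < α e) (hθ0 : ∀ i, 0 < θ i)
    (hlow : ∀ i v, θ i * ‖v‖ ^ 2 ≤ inner ℝ v (hess (f i) (x i) v)) :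
    ∑ i, θ i ^ 2 / (2 * (G.degree i : ℝ) * ⨆ j : G.neighborSet i, α s(i, (j : Fin N))) *
      ‖step G f (quadSurrogate N n) α x i - x i‖ ^ 2 ≤ inner ℝ x (wlap G α x) := by
  rw [inner_wlap_self, Finset.mul_sum]
  refine Finset.sum_le_sum fun i _ => ?_
  have h1 := norm_wlap_apply_sq_le hpos x i
  have h2 := norm_step_sub_apply_le (G := G) (α := α) hθ0 hlow i
  have hm := iSup_neighbor_pos hN hG hpos i
  have hd : (0 : ℝ) < G.degree i := by exact_mod_cast degree_pos_of_connected hN hG i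
  set m := ⨆ j : G.neighborSet i, α s(i, (j : Fin N))
  have hθi := hθ0 i
  rw [le_div_iff₀ hθi] at h2
  have h3 : (‖step G f (quadSurrogate N n) α x i - x i‖ * θ i) ^ 2 ≤ ‖wlap G α x i‖ ^ 2 := by
    gcongr
  rw [div_mul_eq_mul_div, div_le_iff₀ (by positivity)]
  calc _ = (‖step G f (quadSurrogate N n) α x i - x i‖ * θ i) ^ 2 := by ring
    _ ≤ _ := h3.trans h1
    _ = _ := by ring

/-- Decrease of the Lyapunov function along one update, in terms of the displacement. -/
theorem V_step_add_le (hN : 2 ≤ N) (hG : G.Connected) (hpos : ∀ e ∈ G.edgeSet, 0 < α e)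
    (hf : ∀ i, ContDiff ℝ 2 (f i)) (hθ0 : ∀ i, 0 < θ i)
    (hlow : ∀ i v, θ i * ‖v‖ ^ 2 ≤ inner ℝ v (hess (f i) (x i) v)) {S : Fin N → Set (E n)}
    (hS : ∀ i, Convex ℝ (S i)) (hC : ∀ i, HessUpperBound (f i) (S i) (C i))
    (hL : ∀ i, 0 ≤ L i ∧ HessLipschitz (f i) (S i) (L i)) (hx : ∀ i, x i ∈ S i)
    (hx' : ∀ i, step G f (quadSurrogate N n) α x i ∈ S i) (hr : ∀ i, ‖x i - xs‖ ≤ r i) :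
    V f xs (step G f (quadSurrogate N n) α x) +
      ∑ i, (θ i ^ 2 / (2 * (G.degree i : ℝ) * ⨆ j : G.neighborSet i, α s(i, (j : Fin N)))
        - C i / 2 - L i / 2 * r i) * ‖step G f (quadSurrogate N n) α x i - x i‖ ^ 2
      ≤ V f xs x := by
  have h1 := V_step_le_sub_energy hf hθ0 hlow hS hC hL hx hx' hr
  have h2 := sum_norm_step_sub_sq_le_energy hN hG hpos hθ0 hlow
  simp only [sub_mul, add_mul, Finset.sum_sub_distrib, Finset.sum_add_distrib] at h1 ⊢
  linarith

/-- Neighboring states are both close to the optimum, so one step has length at most δ_i; this is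
why C'_i has that radius. -/
theorem norm_step_sub_apply_le_delta {αbar : ℝ} (hf : ∀ i, ObjectiveAssumption (f i))
    (hα : ∀ e ∈ G.edgeSet, 0 < α e ∧ α e ≤ αbar)
    (hθ : ∀ i, 0 < θ i ∧ HessLowerBound (f i) (convexHull ℝ (Cset f xs x0 i)) (θ i))
    (hx : ∀ i, x i ∈ Cset f xs x0 i) (i : Fin N) :
    ‖step G f (quadSurrogate N n) α x i - x i‖ ≤ delta G αbar (V f xs x0) θ i := by
  have hlow : ∀ i v, θ i * ‖v‖ ^ 2 ≤ inner ℝ v (hess (f i) (x i) v) := fun i =>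
    (hθ i).2 _ (subset_convexHull ℝ _ (hx i))
  have hθi := (hθ i).1
  refine (norm_step_sub_apply_le (fun i => (hθ i).1) hlow i).trans ?_
  rw [delta, div_mul_eq_mul_div, Finset.mul_sum, wlap_apply]
  gcongr
  refine (norm_sum_le _ _).trans (Finset.sum_le_sum fun j hj => ?_)
  have h1 := hα s(i, j) (by simpa using hj)
  rw [norm_smul, Real.norm_of_nonneg h1.1.le]
  have h2 : ‖x i - x j‖ ≤ √(2 * V f xs x0 / θ i) + √(2 * V f xs x0 / θ j) := by
    rw [← sub_sub_sub_cancel_right (x i) (x j) xs]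
    exact (norm_sub_le _ _).trans (add_le_add (norm_sub_le_of_mem_Cset hf (hθ i) (hx i))
      (norm_sub_le_of_mem_Cset hf (hθ j) (hx j)))
  have h3 := h1.1.le.trans h1.2
  gcongr
  exact h1.2

theorem le_of_hessBounds (hn : 1 ≤ n) {g : E n → ℝ} {S : Set (E n)} {c d : ℝ} {y : E n}
    (hy : y ∈ S) (hc : HessLowerBound g S c) (hd : HessUpperBound g S d) : c ≤ d := by
  have h := (hc y hy (EuclideanSpace.single ⟨0, hn⟩ 1)).trans
    (hd y hy (EuclideanSpace.single ⟨0, hn⟩ 1))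
  simpa using h

theorem lt_of_stepSizeDrop (hN : 2 ≤ N) (hG : G.Connected) {v0 : ℝ} {θ' Θ' L' : Fin N → ℝ}
    (hpos : ∀ e ∈ G.edgeSet, 0 < α e) (hdrop : StepSizeDrop G v0 θ θ' Θ' L' α) (i : Fin N)
    (hA : 0 < Θ' i - θ' i / 2 + L' i / 2 * √(2 * v0 / θ i)) :
    Θ' i - θ' i / 2 + L' i / 2 * √(2 * v0 / θ i) <
      θ i ^ 2 / (2 * (G.degree i : ℝ) * ⨆ j : G.neighborSet i, α s(i, (j : Fin N))) := by
  obtain ⟨j, hj, h⟩ := exists_iSup_neighbor_eq (α := α) hN hG i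
  have hd : (0 : ℝ) < G.degree i := by exact_mod_cast degree_pos_of_connected hN hG i
  have hαj : 0 < α s(i, j) := hpos _ hj
  have h1 : α s(i, j) < 1 / 2 * stepTerm G v0 θ θ' Θ' L' i :=
    (hdrop i j hj).trans_le (by gcongr; exact min_le_left _ _)
  rw [h, lt_div_iff₀ (by positivity)]
  rw [stepTerm] at h1
  set A := Θ' i - θ' i / 2 + L' i / 2 * √(2 * v0 / θ i)
  have h2 := mul_lt_mul_of_pos_left h1 (by positivity : 0 < 2 * G.degree i * A)
  calc A * (2 * G.degree i * α s(i, j)) = 2 * G.degree i * A * α s(i, j) := by ring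
    _ < _ := h2
    _ = θ i ^ 2 := by field_simp

end Lyapunov

/-! ### Extreme step sizes and the rate -/

section StepSizes

variable {N : ℕ} {G : SimpleGraph (Fin N)} {α : Sym2 (Fin N) → ℝ}

theorem le_alphaMax {e : Sym2 (Fin N)} (he : e ∈ G.edgeSet) : α e ≤ alphaMax G α :=
  le_ciSup (f := fun e : G.edgeSet => α e) (Set.finite_range _).bddAbove ⟨e, he⟩

theorem alphaMin_le {e : Sym2 (Fin N)} (he : e ∈ G.edgeSet) : alphaMin G α ≤ α e :=
  ciInf_le (f := fun e : G.edgeSet => α e) (Set.finite_range _).bddBelow ⟨e, he⟩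

theorem nonempty_edgeSet_of_connected (hN : 2 ≤ N) (hG : G.Connected) : Nonempty G.edgeSet := by
  classical
  obtain ⟨j, hj⟩ := (G.degree_pos_iff_exists_adj _).mp
    (degree_pos_of_connected hN hG ⟨0, by omega⟩)
  exact ⟨⟨s(_, j), hj⟩⟩

theorem exists_alphaMax_eq (hN : 2 ≤ N) (hG : G.Connected) :
    ∃ e ∈ G.edgeSet, alphaMax G α = α e := by
  have := nonempty_edgeSet_of_connected hN hG
  obtain ⟨e, he⟩ := exists_eq_ciSup_of_finite (f := fun e : G.edgeSet => α e)
  exact ⟨e, e.2, he.symm⟩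

theorem exists_alphaMin_eq (hN : 2 ≤ N) (hG : G.Connected) :
    ∃ e ∈ G.edgeSet, alphaMin G α = α e := by
  have := nonempty_edgeSet_of_connected hN hG
  obtain ⟨e, he⟩ := exists_eq_ciInf_of_finite (f := fun e : G.edgeSet => α e)
  exact ⟨e, e.2, he.symm⟩

theorem alphaMin_le_alphaMax (hN : 2 ≤ N) (hG : G.Connected) : alphaMin G α ≤ alphaMax G α := by
  obtain ⟨e, he, h⟩ := exists_alphaMax_eq (α := α) hN hG
  exact h ▸ alphaMin_le he

theorem alphaMin_pos (hN : 2 ≤ N) (hG : G.Connected) (hpos : ∀ e ∈ G.edgeSet, 0 < α e) :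
    0 < alphaMin G α := by
  obtain ⟨e, he, h⟩ := exists_alphaMin_eq (α := α) hN hG
  exact h ▸ hpos e he

variable [DecidableRel G.Adj] {θ Θ : Fin N → ℝ}

theorem rate_nonneg (hN : 2 ≤ N) (hG : G.Connected) (hpos : ∀ e ∈ G.edgeSet, 0 < α e)
    (ht : 0 < ⨅ i, θ i) (htT : (⨅ i, θ i) ≤ ⨆ i, Θ i) : 0 ≤ rate hN G θ Θ α := by
  have h2 := lam2_pos hN hG
  have hb := alphaMin_pos hN hG hpos
  by_contra! hcon
  obtain ⟨h3, h4⟩ := max_lt_iff.mp hcon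
  have h5 : alphaMin G α * lam2 hN G / (⨆ i, Θ i) ≤ alphaMax G α * lamMax hN G / (⨅ i, θ i) :=
    div_le_div₀ (mul_nonneg (hb.le.trans (alphaMin_le_alphaMax hN hG))
      (h2.le.trans (lam2_le_lamMax hN))) (mul_le_mul (alphaMin_le_alphaMax hN hG)
      (lam2_le_lamMax hN) h2.le (hb.le.trans (alphaMin_le_alphaMax hN hG))) ht htT
  linarith

theorem rate_lt_one (hN : 2 ≤ N) (hG : G.Connected) (hpos : ∀ e ∈ G.edgeSet, 0 < α e)
    (ht : 0 < ⨅ i, θ i) (hT : 0 < ⨆ i, Θ i)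
    (hα : ∀ e ∈ G.edgeSet, α e < (⨅ i, θ i) / (G.maxDegree : ℝ)) : rate hN G θ Θ α < 1 := by
  have h2 := lam2_pos hN hG
  have hb := alphaMin_pos hN hG hpos
  have hD : (0 : ℝ) < G.maxDegree := by
    exact_mod_cast (degree_pos_of_connected hN hG ⟨0, by omega⟩).trans_le
      (G.degree_le_maxDegree _)
  obtain ⟨e, he, h⟩ := exists_alphaMax_eq (α := α) hN hG
  have h3 := hα e he
  rw [← h, lt_div_iff₀ hD] at h3
  refine max_lt ?_ ?_
  · have h4 : alphaMax G α * lamMax hN G ≤ alphaMax G α * (2 * G.maxDegree) := by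
      have := hb.le.trans (alphaMin_le_alphaMax hN hG)
      gcongr
      exact lamMax_le_two_mul_maxDegree hN
    have h5 : alphaMax G α * lamMax hN G / (⨅ i, θ i) < 2 := by
      rw [div_lt_iff₀ ht]
      linarith
    linarith
  · have : 0 < alphaMin G α * lam2 hN G / (⨆ i, Θ i) := by positivity
    linarith

theorem eq_top_of_rate_eq_zero (hN : 2 ≤ N) (hG : G.Connected)
    (hpos : ∀ e ∈ G.edgeSet, 0 < α e) (ht : 0 < ⨅ i, θ i) (htT : (⨅ i, θ i) ≤ ⨆ i, Θ i)
    (h : rate hN G θ Θ α = 0) :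
    G = ⊤ ∧ (⨅ i, θ i) = (⨆ i, Θ i) ∧ ∀ e ∈ G.edgeSet, α e = (⨅ i, θ i) / N := by
  have h2 := lam2_pos hN hG
  have hb := alphaMin_pos hN hG hpos
  have hab := alphaMin_le_alphaMax (α := α) hN hG
  have hl := lam2_le_lamMax (G := G) hN
  have hN0 : (0 : ℝ) < N := by exact_mod_cast (by omega : 0 < N)
  obtain ⟨h3, h4⟩ := max_le_iff.mp (le_of_eq h)
  have h5 : alphaMax G α * lamMax hN G ≤ ⨅ i, θ i := by
    have : alphaMax G α * lamMax hN G / (⨅ i, θ i) ≤ 1 := by linarith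
    rwa [div_le_one ht] at this
  have h6 : (⨆ i, Θ i) ≤ alphaMin G α * lam2 hN G := by
    have : 1 ≤ alphaMin G α * lam2 hN G / (⨆ i, Θ i) := by linarith
    rwa [one_le_div (ht.trans_le htT)] at this
  have h7 : alphaMin G α * lam2 hN G ≤ alphaMin G α * lamMax hN G := by gcongr
  have h8 : alphaMin G α * lamMax hN G ≤ alphaMax G α * lamMax hN G := by
    have := h2.le.trans hl
    gcongr
  -- The chain Θ ≤ min α · λ₂ ≤ min α · λ_max ≤ max α · λ_max ≤ θ ≤ Θ collapses to equalities.
  have hlam : lam2 hN G = lamMax hN G := mul_left_cancel₀ hb.ne' (by linarith)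
  have hαeq : alphaMin G α = alphaMax G α :=
    mul_right_cancel₀ (h2.trans_le hl).ne' (by linarith)
  obtain ⟨htop, hlN⟩ := eq_top_of_lam2_eq_lamMax hN hG hlam
  refine ⟨htop, by linarith, fun e he => ?_⟩
  have h9 : α e = alphaMax G α := le_antisymm (le_alphaMax he) (hαeq ▸ alphaMin_le he)
  rw [h9, eq_div_iff hN0.ne', ← hlN]
  linarith

end StepSizes

/-! ### Geometric convergence to consensus -/

section Convergence

variable {N n : ℕ} {G : SimpleGraph (Fin N)} [DecidableRel G.Adj] {α : Sym2 (Fin N) → ℝ}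

variable (G α) in
theorem continuous_inner_wlap_self :
    Continuous fun z : Stack N n => inner ℝ z (wlap G α z) := by
  simp only [inner_wlap_self]
  fun_prop

/-- A sequence whose energy contracts by `q²` and whose displacements are controlled by the
weighted Laplacian converges geometrically to a consensus vector. -/
theorem exists_consensus_limit (hN : 2 ≤ N) (hG : G.Connected)
    (hpos : ∀ e ∈ G.edgeSet, 0 < α e) {c q : ℝ} (hc : 0 < c) (hq0 : 0 ≤ q) (hq1 : q < 1)
    {x : ℕ → Stack N n}
    (henergy : ∀ k, inner ℝ (x (k + 1)) (wlap G α (x (k + 1))) ≤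
      q ^ 2 * inner ℝ (x k) (wlap G α (x k)))
    (hdisp : ∀ k, ‖x (k + 1) - x k‖ ≤ ‖wlap G α (x k)‖ / c) :
    ∃ z : E n, Filter.Tendsto x Filter.atTop (nhds (consensus N z)) ∧
      ∀ k, ‖x k - consensus N z‖ ≤
        alphaMax G α * lamMax hN G / (c * (1 - q)) * ‖x 0‖ * q ^ k := by
  have ha : 0 < alphaMax G α := (alphaMin_pos hN hG hpos).trans_le (alphaMin_le_alphaMax hN hG)
  have hl : 0 < lamMax hN G := (lam2_pos hN hG).trans_le (lam2_le_lamMax hN)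
  have hQ : ∀ k, inner ℝ (x k) (wlap G α (x k)) ≤
      alphaMax G α * lamMax hN G * (‖x 0‖ * q ^ k) ^ 2 := by
    intro k
    induction k with
    | zero => simpa using inner_wlap_self_le hN ha.le (fun e he => le_alphaMax he) (x 0)
    | succ k ih =>
      refine (henergy k).trans ((mul_le_mul_of_nonneg_left ih (sq_nonneg q)).trans_eq ?_)
      ring
  have hstep : ∀ k, dist (x k) (x (k + 1)) ≤ alphaMax G α * lamMax hN G / c * ‖x 0‖ * q ^ k := by
    intro k
    rw [dist_comm, dist_eq_norm]
    refine (hdisp k).trans ?_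
    have h1 := norm_wlap_sq_le hN hG ha hpos (fun e he => le_alphaMax he) (x k)
    have h2 : ‖wlap G α (x k)‖ ^ 2 ≤ (alphaMax G α * lamMax hN G * (‖x 0‖ * q ^ k)) ^ 2 :=
      h1.trans ((mul_le_mul_of_nonneg_left (hQ k) (by positivity)).trans_eq (by ring))
    have h3 := le_of_sq_le_sq h2 (by positivity)
    calc ‖wlap G α (x k)‖ / c ≤ alphaMax G α * lamMax hN G * (‖x 0‖ * q ^ k) / c := by gcongr
      _ = _ := by ring
  obtain ⟨y, hy⟩ := cauchySeq_tendsto_of_complete (cauchySeq_of_le_geometric q _ hq1 hstep)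
  -- The energy is continuous and tends to zero along the sequence, so the limit lies in the kernel
  -- of W.
  have hQ0 : inner ℝ y (wlap G α y) = 0 := by
    refine le_antisymm ?_ (inner_wlap_self_nonneg hpos y)
    have h1 : Filter.Tendsto (fun k => alphaMax G α * lamMax hN G * (‖x 0‖ * q ^ k) ^ 2)
        Filter.atTop (nhds 0) := by
      have := (((tendsto_pow_atTop_nhds_zero_of_lt_one hq0 hq1).const_mul ‖x 0‖).pow 2).const_mul
        (alphaMax G α * lamMax hN G)
      simpa using this
    exact le_of_tendsto_of_tendsto' (((continuous_inner_wlap_self G α).tendsto y).comp hy) h1 hQ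
  have hcons : y = consensus N (y ⟨0, by omega⟩) := by
    ext1 i
    exact eq_consensus_of_inner_wlap_self_eq_zero hG hpos hQ0 i _
  refine ⟨y ⟨0, by omega⟩, hcons ▸ hy, fun k => ?_⟩
  rw [← hcons, ← dist_eq_norm]
  refine (dist_le_of_le_geometric_of_tendsto q _ hq1 hstep hy k).trans_eq ?_
  have : 1 - q ≠ 0 := by linarith
  field_simp

theorem norm_consensus (z : E n) : ‖consensus N z‖ = √(N : ℝ) * ‖z‖ := by
  have h : ‖consensus N z‖ ^ 2 = (√(N : ℝ) * ‖z‖) ^ 2 := by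
    rw [norm_stack_sq, mul_pow, Real.sq_sqrt (by positivity)]
    simp [consensus]
  exact (sq_eq_sq₀ (norm_nonneg _) (by positivity)).mp h

theorem tendsto_apply_of_tendsto_consensus {x : ℕ → Stack N n} {z : E n}
    (h : Filter.Tendsto x Filter.atTop (nhds (consensus N z))) (i : Fin N) :
    Filter.Tendsto (fun k => x k i) Filter.atTop (nhds z) :=
  ((PiLp.continuous_apply 2 (fun _ : Fin N => E n) i).tendsto (consensus N z)).comp h

end Convergence

/-! ### Descent, gradient drift and the error bound -/

section Optimality

variable {N n : ℕ} {G : SimpleGraph (Fin N)} [DecidableRel G.Adj] {α : Sym2 (Fin N) → ℝ}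
  {f : Fin N → E n → ℝ} {xs : E n} {x0 x : Stack N n} {θ Θ L : Fin N → ℝ}

theorem V_step_le {θ' Θ' L' : Fin N → ℝ} {αbar : ℝ} (hN : 2 ≤ N) (hn : 1 ≤ n) (hG : G.Connected)
    (hf : ∀ i, ObjectiveAssumption (f i)) (hα : ∀ e ∈ G.edgeSet, 0 < α e ∧ α e ≤ αbar)
    (hθ : ∀ i, 0 < θ i ∧ HessLowerBound (f i) (convexHull ℝ (Cset f xs x0 i)) (θ i))
    (hθ' : ∀ i, 0 < θ' i ∧ HessLowerBound (f i) (Cset' G f xs x0 αbar θ i) (θ' i))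
    (hΘ' : ∀ i, 0 < Θ' i ∧ HessUpperBound (f i) (Cset' G f xs x0 αbar θ i) (Θ' i))
    (hL' : ∀ i, 0 ≤ L' i ∧ HessLipschitz (f i) (Cset' G f xs x0 αbar θ i) (L' i))
    (hdrop : StepSizeDrop G (V f xs x0) θ θ' Θ' L' α) (hx : V f xs x ≤ V f xs x0) :
    V f xs (step G f (quadSurrogate N n) α x) ≤ V f xs x := by
  have hmem := mem_Cset_of_V_le hf hx
  have hpos : ∀ e ∈ G.edgeSet, 0 < α e := fun e he => (hα e he).1
  have hδ := fun i => norm_step_sub_apply_le_delta hf hα hθ hmem i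
  have hxC : ∀ i, x i ∈ Cset' G f xs x0 αbar θ i := fun i => subset_convexHull ℝ _
    ⟨x i, hmem i, by simpa using (norm_nonneg _).trans (hδ i)⟩
  have h1 := V_step_add_le hN hG hpos (fun i => (hf i).contDiff) (fun i => (hθ i).1)
    (fun i => (hθ i).2 _ (subset_convexHull ℝ _ (hmem i))) (fun i => convex_convexHull ℝ _)
    (fun i => (hΘ' i).2) hL' hxC
    (fun i => subset_convexHull ℝ _ ⟨x i, hmem i, hδ i⟩)
    (fun i => norm_sub_le_of_mem_Cset hf (hθ i) (hmem i))
  refine le_trans (le_add_of_nonneg_right (Finset.sum_nonneg fun i _ => ?_)) h1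
  refine mul_nonneg ?_ (sq_nonneg _)
  have h2 : θ' i ≤ Θ' i := le_of_hessBounds hn (hxC i) (hθ' i).2 (hΘ' i).2
  have h3 : 0 ≤ L' i / 2 * √(2 * V f xs x0 / θ i) :=
    mul_nonneg (div_nonneg (hL' i).1 zero_le_two) (Real.sqrt_nonneg _)
  have h4 := (hθ' i).1
  have h5 := lt_of_stepSizeDrop hN hG hpos hdrop i (by linarith)
  linarith

theorem V_step_add_rho_le (hN : 2 ≤ N) (hn : 1 ≤ n) (hG : G.Connected)
    (hf : ∀ i, ObjectiveAssumption (f i)) (hpos : ∀ e ∈ G.edgeSet, 0 < α e)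
    (hθ : ∀ i, 0 < θ i ∧ HessLowerBound (f i) (convexHull ℝ (Cset f xs x0 i)) (θ i))
    (hΘ : ∀ i, HessUpperBound (f i) (convexHull ℝ (Cset f xs x0 i)) (Θ i))
    (hL : ∀ i, 0 ≤ L i ∧ HessLipschitz (f i) (convexHull ℝ (Cset f xs x0 i)) (L i))
    (hx : V f xs x ≤ V f xs x0)
    (hx' : V f xs (step G f (quadSurrogate N n) α x) ≤ V f xs x0) :
    V f xs (step G f (quadSurrogate N n) α x) + ∑ i, rho G (V f xs x0) θ Θ L α i *
      ‖step G f (quadSurrogate N n) α x i - x i‖ ^ 2 ≤ V f xs x := by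
  have hmem := fun i => subset_convexHull ℝ _ (mem_Cset_of_V_le hf hx i)
  have hmem' := fun i => subset_convexHull ℝ _ (mem_Cset_of_V_le hf hx' i)
  refine le_trans ?_ (V_step_add_le hN hG hpos (fun i => (hf i).contDiff) (fun i => (hθ i).1)
    (fun i => (hθ i).2 _ (hmem i)) (fun i => convex_convexHull ℝ _) hΘ hL hmem hmem'
    (fun i => norm_sub_le_of_mem_Cset hf (hθ i) (mem_Cset_of_V_le hf hx i)))
  -- `rho` carries θ_i/2 - Θ_i where the estimate has -Θ_i/2; since θ_i ≤ Θ_i this only weakens it.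
  gcongr with i
  have := le_of_hessBounds hn (hmem i) (hθ i).2 (hΘ i)
  rw [rho]
  linarith

theorem norm_sum_gradient_step_sub_le (hf : ∀ i, ObjectiveAssumption (f i))
    (hθ : ∀ i, 0 < θ i ∧ HessLowerBound (f i) (convexHull ℝ (Cset f xs x0 i)) (θ i))
    (hL : ∀ i, 0 ≤ L i ∧ HessLipschitz (f i) (convexHull ℝ (Cset f xs x0 i)) (L i))
    (hx : V f xs x ≤ V f xs x0)
    (hx' : V f xs (step G f (quadSurrogate N n) α x) ≤ V f xs x0) :
    ‖∑ i, gradient (f i) (step G f (quadSurrogate N n) α x i) - ∑ i, gradient (f i) (x i)‖ ≤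
      ∑ i, L i / 2 * ‖step G f (quadSurrogate N n) α x i - x i‖ ^ 2 := by
  have hmem := fun i => subset_convexHull ℝ _ (mem_Cset_of_V_le hf hx i)
  have hmem' := fun i => subset_convexHull ℝ _ (mem_Cset_of_V_le hf hx' i)
  have h1 : ∑ i, gradient (f i) (step G f (quadSurrogate N n) α x i) - ∑ i, gradient (f i) (x i)
      = ∑ i, (gradient (f i) (step G f (quadSurrogate N n) α x i) - gradient (f i) (x i)
        - hess (f i) (x i) (step G f (quadSurrogate N n) α x i - x i)) := by
    simp only [hess_step_sub (fun i => (hθ i).1) (fun i => (hθ i).2 _ (hmem i)),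
      Finset.sum_sub_distrib, Finset.sum_neg_distrib, sum_wlap_apply]
    simp
  rw [h1]
  exact (norm_sum_le _ _).trans (Finset.sum_le_sum fun i _ =>
    (hL i).2.norm_gradient_remainder_le (hf i).contDiff (convex_convexHull ℝ _) (hmem i) (hmem' i))

theorem sum_gradient_eq_zero_of_isMinOn (hf : ∀ i, ContDiff ℝ 2 (f i))
    (hxs : IsMinOn (fun x => ∑ i, f i x) Set.univ xs) : ∑ i, gradient (f i) xs = 0 := by
  rw [← gradient_eq_zero_of_isMinOn hxs]
  refine ext_inner_right ℝ fun v => ?_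
  rw [inner_gradient_left, sum_inner, fderiv_fun_sum
    (fun i _ => (hf i).differentiable (by norm_num) xs), sum_apply]
  simp only [inner_gradient_left]

theorem norm_sub_optimum_le (hN : 0 < N) (hf : ∀ i, ContDiff ℝ 2 (f i)) {S : Set (E n)}
    (hS : Convex ℝ S) {θbar : Fin N → ℝ} (hθbar : ∀ i, 0 < θbar i ∧ HessLowerBound (f i) S (θbar i))
    (hxs : ∑ i, gradient (f i) xs = 0) (hxsS : xs ∈ S) {z : E n} (hz : z ∈ S) :
    ‖z - xs‖ ≤ ‖∑ i, gradient (f i) z‖ / ∑ i, θbar i := by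
  have hsum : 0 < ∑ i, θbar i :=
    Finset.sum_pos (fun i _ => (hθbar i).1) ⟨⟨0, hN⟩, Finset.mem_univ _⟩
  have h1 := Finset.sum_le_sum fun i (_ : i ∈ Finset.univ) =>
    (hθbar i).2.le_inner_gradient_sub (hf i) hS hxsS hz
  rw [← Finset.sum_mul, ← sum_inner, Finset.sum_sub_distrib, hxs, sub_zero] at h1
  have h2 := h1.trans (real_inner_le_norm _ _)
  rw [le_div_iff₀ hsum]
  rcases (norm_nonneg (z - xs)).eq_or_lt with h | h
  · rw [← h, zero_mul]; positivity
  · nlinarith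

theorem rho_pos {θ' Θ' L' : Fin N → ℝ} {v0 : ℝ} (hN : 2 ≤ N) (hG : G.Connected)
    (hpos : ∀ e ∈ G.edgeSet, 0 < α e) (hdrop : StepSizeDrop G v0 θ θ' Θ' L' α) {i : Fin N}
    (hθΘ : θ i ≤ Θ i) (hθ : 0 < θ i) (hL : 0 ≤ L i)
    (hmono : θ' i ≤ θ i ∧ Θ i ≤ Θ' i ∧ L i ≤ L' i) : 0 < rho G v0 θ Θ L α i := by
  have h1 := Real.sqrt_nonneg (2 * v0 / θ i)
  have h2 := mul_nonneg hL h1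
  have h3 := mul_le_mul_of_nonneg_right hmono.2.2 h1
  have h4 := lt_of_stepSizeDrop hN hG hpos hdrop i (by linarith [hmono.1, hmono.2.1])
  rw [rho]
  linarith [hmono.1, hmono.2.1]

/-- The error bound vanishes at least linearly in the largest step size. -/
theorem exists_errorBound_le (hN : 2 ≤ N) (hG : G.Connected) {v0 : ℝ} (hv0 : 0 ≤ v0)
    {θbar : Fin N → ℝ} (hθ : ∀ i, 0 < θ i) (hΘ : ∀ i, 0 < Θ i) (hL : ∀ i, 0 ≤ L i)
    (hθbar : ∀ i, 0 < θbar i) :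
    ∃ C > 0, ∃ α₀ > 0, ∀ α : Sym2 (Fin N) → ℝ, (∀ e ∈ G.edgeSet, 0 < α e ∧ α e ≤ α₀) →
      errorBound G v0 θ Θ L θbar α ≤ C * alphaMax G α := by
  have : Nonempty (Fin N) := ⟨⟨0, by omega⟩⟩
  have hd : ∀ i, (0 : ℝ) < G.degree i := fun i => by
    exact_mod_cast degree_pos_of_connected hN hG i
  set B : Fin N → ℝ := fun i => Θ i + L i / 2 * √(2 * v0 / θ i) with hB
  have hB0 : ∀ i, 0 < B i := fun i => add_pos_of_pos_of_nonneg (hΘ i)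
    (mul_nonneg (div_nonneg (hL i) zero_le_two) (Real.sqrt_nonneg _))
  -- Below this threshold B i is at most half of the leading term of `rho` with max α in place of
  -- the local maximum, so `rho` is at least the other half.
  set r : Fin N → ℝ := fun i => θ i ^ 2 / (4 * G.degree i * B i) with hr
  have hr0 : ∀ i, 0 < r i := fun i => by
    have h1 := hθ i
    have h2 := hd i
    have h3 := hB0 i
    positivity
  set K : Fin N → ℝ := fun i => L i * (4 * G.degree i) / θ i ^ 2 with hK
  set W : ℝ := √(N : ℝ) * v0 / (2 * ∑ i, θbar i) with hW
  have hW0 : 0 ≤ W := div_nonneg (by positivity)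
    (mul_nonneg zero_le_two (Finset.sum_nonneg fun i _ => (hθbar i).le))
  have hK0 : 0 ≤ ⨆ i, K i := Real.iSup_nonneg fun i => by
    have h1 := hL i
    positivity
  -- The summand 1 keeps the constant positive when every L i, or v0, is zero.
  refine ⟨(⨆ i, K i) * W + 1, by positivity, ⨅ i, r i, ?_, fun α hα => ?_⟩
  · obtain ⟨i, hi⟩ := exists_eq_ciInf_of_finite (f := r)
    exact hi ▸ hr0 i
  have hpos : ∀ e ∈ G.edgeSet, 0 < α e := fun e he => (hα e he).1
  obtain ⟨e, he, hmax⟩ := exists_alphaMax_eq (α := α) hN hG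
  have ha : 0 < alphaMax G α := hmax ▸ hpos e he
  have hsup : (⨆ i, L i / rho G v0 θ Θ L α i) ≤ (⨆ i, K i) * alphaMax G α := by
    refine ciSup_le fun i => ?_
    have hθi := hθ i
    have hdi := hd i
    have hBi := hB0 i
    have h1 : alphaMax G α ≤ r i := by
      rw [hmax]
      exact (hα e he).2.trans (ciInf_le (Set.finite_range _).bddBelow i)
    have h2 : B i ≤ θ i ^ 2 / (4 * G.degree i * alphaMax G α) := by
      rw [hr, le_div_iff₀ (by positivity)] at h1
      rw [le_div_iff₀ (by positivity)]
      linarith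
    obtain ⟨j, hj, hm⟩ := exists_iSup_neighbor_eq (α := α) hN hG i
    have h3 : θ i ^ 2 / (2 * G.degree i * alphaMax G α) ≤
        θ i ^ 2 / (2 * (G.degree i : ℝ) * ⨆ j : G.neighborSet i, α s(i, (j : Fin N))) := by
      have h5 : 0 < α s(i, j) := hpos _ hj
      rw [hm]
      gcongr
      exact le_alphaMax hj
    have h4 : θ i ^ 2 / (2 * G.degree i * alphaMax G α) =
        2 * (θ i ^ 2 / (4 * G.degree i * alphaMax G α)) := by
      field_simp
      ring
    have h6 : θ i ^ 2 / (4 * G.degree i * alphaMax G α) ≤ rho G v0 θ Θ L α i := by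
      rw [rho]
      simp only [hB] at h2
      linarith
    calc L i / rho G v0 θ Θ L α i ≤ L i / (θ i ^ 2 / (4 * G.degree i * alphaMax G α)) := by
          have := hL i
          gcongr
      _ = K i * alphaMax G α := by
          rw [hK]
          field_simp
      _ ≤ (⨆ i, K i) * alphaMax G α := by
          gcongr
          exact le_ciSup (Set.finite_range _).bddAbove i
  calc errorBound G v0 θ Θ L θbar α ≤ (⨆ i, K i) * alphaMax G α * W := by
        rw [errorBound]
        gcongr
    _ ≤ ((⨆ i, K i) * W + 1) * alphaMax G α := by linarith

end Optimality

/-! ### Convergence and optimality error of the iterates -/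

/-- The iterates converge geometrically to a consensus vector, whose distance to the optimum is
controlled by the accumulated drift of the summed gradients. -/
theorem exists_limit_of_stepSize {N n : ℕ} (hN : 2 ≤ N) (hn : 1 ≤ n)
    {G : SimpleGraph (Fin N)} [DecidableRel G.Adj] (hG : G.Connected)
    {f : Fin N → E n → ℝ} (hf : ∀ i, ObjectiveAssumption (f i))
    {xs : E n} (hxs : IsMinOn (fun x => ∑ i, f i x) Set.univ xs)
    {x0 : Stack N n} (hx0 : ∀ i, IsMinOn (f i) Set.univ (x0 i))
    {θ Θ L θbar : Fin N → ℝ} {α : Sym2 (Fin N) → ℝ}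
    (hθ : ∀ i, 0 < θ i ∧ HessLowerBound (f i) (convexHull ℝ (Cset f xs x0 i)) (θ i))
    (hΘ : ∀ i, 0 < Θ i ∧ HessUpperBound (f i) (convexHull ℝ (Cset f xs x0 i)) (Θ i))
    (hL : ∀ i, 0 ≤ L i ∧ HessLipschitz (f i) (convexHull ℝ (Cset f xs x0 i)) (L i))
    (hθbar : ∀ i, 0 < θbar i ∧
      HessLowerBound (f i) (convexHull ℝ (⋃ j, Cset f xs x0 j)) (θbar i))
    (hpos : ∀ e ∈ G.edgeSet, 0 < α e)
    (hdesc : ∀ x, V f xs x ≤ V f xs x0 → V f xs (step G f (quadSurrogate N n) α x) ≤ V f xs x)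
    (ht : 0 < ⨅ i, θ i) (hT : 0 < ⨆ i, Θ i)
    (hq0 : 0 ≤ rate hN G θ Θ α) (hq1 : rate hN G θ Θ α < 1)
    (hrho : ∀ i, 0 < rho G (V f xs x0) θ Θ L α i) :
    ∃ xt : E n,
      (∀ k, ‖iterate G f (quadSurrogate N n) α x0 k - consensus N xt‖ ≤
        alphaMax G α * lamMax hN G / ((⨅ i, θ i) * (1 - rate hN G θ Θ α))
          * ‖x0‖ * rate hN G θ Θ α ^ k) ∧
      ‖consensus N xt - consensus N xs‖ ≤ errorBound G (V f xs x0) θ Θ L θbar α := by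
  set x : ℕ → Stack N n := iterate G f (quadSurrogate N n) α x0 with hxdef
  have hsucc : ∀ k, x (k + 1) = step G f (quadSurrogate N n) α (x k) := fun k => rfl
  have hVk : ∀ k, V f xs (x k) ≤ V f xs x0 := by
    intro k
    induction k with
    | zero => exact le_rfl
    | succ k ih => exact (hdesc _ ih).trans ih
  have hmem : ∀ k i, x k i ∈ convexHull ℝ (Cset f xs x0 i) := fun k i =>
    subset_convexHull ℝ _ (mem_Cset_of_V_le hf (hVk k) i)
  have hlow : ∀ k i v, (⨅ i, θ i) * ‖v‖ ^ 2 ≤ inner ℝ v (hess (f i) (x k i) v) := fun k i v =>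
    (mul_le_mul_of_nonneg_right (ciInf_le (Set.finite_range _).bddBelow i) (sq_nonneg _)).trans
      ((hθ i).2 _ (hmem k i) v)
  have hup : ∀ k i v, inner ℝ v (hess (f i) (x k i) v) ≤ (⨆ i, Θ i) * ‖v‖ ^ 2 := fun k i v =>
    ((hΘ i).2 _ (hmem k i) v).trans
      (mul_le_mul_of_nonneg_right (le_ciSup (Set.finite_range _).bddAbove i) (sq_nonneg _))
  have hb := alphaMin_pos hN hG hpos
  obtain ⟨z, hz, hrate⟩ := exists_consensus_limit hN hG hpos ht hq0 hq1 (x := x)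
    (fun k => energy_step_le hN hG (fun i => (hf i).contDiff) hb (fun e he => alphaMin_le he)
      (fun e he => le_alphaMax he) (hb.trans_le (alphaMin_le_alphaMax hN hG)) ht hT hq0
      (le_max_left _ _) (le_max_right _ _) (hlow k) (hup k))
    (fun k => norm_step_sub_le ht (hlow k))
  refine ⟨z, hrate, ?_⟩
  set R := ⨆ i, L i / rho G (V f xs x0) θ Θ L α i with hR
  -- Telescoping: each step raises the left side by at most Σ (L_i/2)‖Δ_i‖² ≤ (R/2) Σ ρ̃_i‖Δ_i‖²,
  -- which the drop in V covers. The base case uses that each node starts at its own minimizer.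
  have hgrad : ∀ k, ‖∑ i, gradient (f i) (x k i)‖ ≤ R / 2 * (V f xs x0 - V f xs (x k)) := by
    intro k
    induction k with
    | zero =>
      have h0 : ∑ i, gradient (f i) (x 0 i) = 0 :=
        Finset.sum_eq_zero fun i _ => gradient_eq_zero_of_isMinOn (hx0 i)
      rw [h0, norm_zero, show x 0 = x0 from rfl, sub_self, mul_zero]
    | succ k ih =>
      have h1 := norm_sum_gradient_step_sub_le hf hθ hL (hVk k) (hVk (k + 1))
      have h2 := V_step_add_rho_le hN hn hG hf hpos hθ (fun i => (hΘ i).2) hL (hVk k) (hVk (k + 1))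
      rw [← hsucc] at h1 h2
      have hR0 : 0 ≤ R := Real.iSup_nonneg fun i => div_nonneg (hL i).1 (hrho i).le
      have h3 : ∑ i, L i / 2 * ‖x (k + 1) i - x k i‖ ^ 2 ≤
          R / 2 * ∑ i, rho G (V f xs x0) θ Θ L α i * ‖x (k + 1) i - x k i‖ ^ 2 := by
        rw [Finset.mul_sum]
        refine Finset.sum_le_sum fun i _ => ?_
        have h4 : L i / rho G (V f xs x0) θ Θ L α i ≤ R :=
          le_ciSup (f := fun i => L i / rho G (V f xs x0) θ Θ L α i)
            (Set.finite_range _).bddAbove i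
        rw [div_le_iff₀ (hrho i)] at h4
        rw [← mul_assoc]
        gcongr
        linarith
      have h5 := norm_le_norm_add_norm_sub (∑ i, gradient (f i) (x k i))
        (∑ i, gradient (f i) (x (k + 1) i))
      rw [norm_sub_rev] at h5
      have h6 : R / 2 * ∑ i, rho G (V f xs x0) θ Θ L α i * ‖x (k + 1) i - x k i‖ ^ 2 ≤
          R / 2 * (V f xs (x k) - V f xs (x (k + 1))) := by
        gcongr
        linarith
      linarith
  have hzi := tendsto_apply_of_tendsto_consensus hz
  -- The sublevel sets are closed, so z lies where the strong convexity constants θ̄_i are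
  -- available.
  have hzC : ∀ i, z ∈ Cset f xs x0 i := fun i =>
    le_of_tendsto' (((continuous_bregman (hf i).contDiff xs).tendsto z).comp (hzi i))
      fun k => mem_Cset_of_V_le hf (hVk k) i
  have hR0 : 0 ≤ R := Real.iSup_nonneg fun i => div_nonneg (hL i).1 (hrho i).le
  have hgz : ‖∑ i, gradient (f i) z‖ ≤ R / 2 * V f xs x0 := by
    refine le_of_tendsto' (tendsto_finsetSum _ fun i _ =>
      ((contDiff_gradient (hf i).contDiff).continuous.tendsto z).comp (hzi i)).norm fun k => ?_
    refine (hgrad k).trans ?_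
    gcongr
    linarith [V_nonneg (xs := xs) hf (x k)]
  have hN0 : 0 < N := by omega
  have hsub : ∀ {y : E n}, y ∈ Cset f xs x0 ⟨0, hN0⟩ → y ∈ convexHull ℝ (⋃ j, Cset f xs x0 j) :=
    fun hy => subset_convexHull ℝ _ (Set.mem_iUnion_of_mem _ hy)
  have hfin := norm_sub_optimum_le hN0 (fun i => (hf i).contDiff) (convex_convexHull ℝ _) hθbar
    (sum_gradient_eq_zero_of_isMinOn (fun i => (hf i).contDiff) hxs)
    (hsub (optimum_mem_Cset hf _)) (hsub (hzC _))
  have hsum : 0 < ∑ i, θbar i :=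
    Finset.sum_pos (fun i _ => (hθbar i).1) ⟨⟨0, hN0⟩, Finset.mem_univ _⟩
  calc ‖consensus N z - consensus N xs‖ = ‖consensus N (z - xs)‖ := rfl
    _ = √(N : ℝ) * ‖z - xs‖ := norm_consensus _
    _ ≤ √(N : ℝ) * (R / 2 * V f xs x0 / ∑ i, θbar i) := by
        gcongr
        exact hfin.trans (by gcongr)
    _ = errorBound G (V f xs x0) θ Θ L θbar α := by
        rw [errorBound, ← hR]
        field_simp

end DEAN

end

/-! ### The main theorem -/

theorem theorem3 {N n : ℕ} (hN : 2 ≤ N) (hn : 1 ≤ n)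
    (G : SimpleGraph (Fin N)) [DecidableRel G.Adj] (hG : G.Connected)
    (f : Fin N → DEAN.E n → ℝ) (hf : ∀ i, DEAN.ObjectiveAssumption (f i))
    -- the optimal solution of the network problem
    (xs : DEAN.E n) (hxs : IsMinOn (fun x => ∑ i, f i x) Set.univ xs)
    (hcoercive : ∀ i, Filter.Tendsto (DEAN.bregman (f i) xs)
      (Filter.cocompact (DEAN.E n)) Filter.atTop)
    -- the initial state: every node starts at the minimizer of its own objective
    (x0 : DEAN.Stack N n) (hx0 : ∀ i, IsMinOn (f i) Set.univ (x0 i))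
    (αbar : ℝ) (hαbar : 0 < αbar)
    (θ Θ L θ' Θ' L' θbar : Fin N → ℝ)
    -- curvature constants on `conv C_i`
    (hθ : ∀ i, 0 < θ i ∧ DEAN.HessLowerBound (f i) (convexHull ℝ (DEAN.Cset f xs x0 i)) (θ i))
    (hΘ : ∀ i, 0 < Θ i ∧ DEAN.HessUpperBound (f i) (convexHull ℝ (DEAN.Cset f xs x0 i)) (Θ i))
    (hL : ∀ i, 0 ≤ L i ∧ DEAN.HessLipschitz (f i) (convexHull ℝ (DEAN.Cset f xs x0 i)) (L i))
    -- curvature constants on `C'_i`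
    (hθ' : ∀ i, 0 < θ' i ∧ DEAN.HessLowerBound (f i) (DEAN.Cset' G f xs x0 αbar θ i) (θ' i))
    (hΘ' : ∀ i, 0 < Θ' i ∧ DEAN.HessUpperBound (f i) (DEAN.Cset' G f xs x0 αbar θ i) (Θ' i))
    (hL' : ∀ i, 0 ≤ L' i ∧ DEAN.HessLipschitz (f i) (DEAN.Cset' G f xs x0 αbar θ i) (L' i))
    (hmono : ∀ i, θ' i ≤ θ i ∧ Θ i ≤ Θ' i ∧ L i ≤ L' i)
    -- convexity parameters on `conv (⋃ j, C_j)`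
    (hθbar : ∀ i, 0 < θbar i ∧
      DEAN.HessLowerBound (f i) (convexHull ℝ (⋃ j, DEAN.Cset f xs x0 j)) (θbar i)) :
    (∀ α : Sym2 (Fin N) → ℝ,
      (∀ e ∈ G.edgeSet, 0 < α e ∧ α e ≤ αbar) →
      DEAN.StepSizeDrop G (DEAN.V f xs x0) θ θ' Θ' L' α →
      (∀ e ∈ G.edgeSet, α e < (⨅ i, θ i) / (G.maxDegree : ℝ)) →
      -- the rate lies in `[0, 1)`, and is positive outside one degenerate configuration
      (0 ≤ DEAN.rate hN G θ Θ α ∧ DEAN.rate hN G θ Θ α < 1 ∧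
        (DEAN.rate hN G θ Θ α = 0 →
          G = ⊤ ∧ (⨅ i, θ i) = (⨆ i, Θ i) ∧ ∀ e ∈ G.edgeSet, α e = (⨅ i, θ i) / N)) ∧
      (∀ i, 0 < DEAN.rho G (DEAN.V f xs x0) θ Θ L α i) ∧
      ∃ xt : DEAN.E n,
        (∀ k, ‖DEAN.iterate G f (DEAN.quadSurrogate N n) α x0 k - DEAN.consensus N xt‖ ≤
          DEAN.alphaMax G α * DEAN.lamMax hN G / ((⨅ i, θ i) * (1 - DEAN.rate hN G θ Θ α))
            * ‖x0‖ * DEAN.rate hN G θ Θ α ^ k) ∧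
        ‖DEAN.consensus N xt - DEAN.consensus N xs‖ ≤
          DEAN.errorBound G (DEAN.V f xs x0) θ Θ L θbar α) ∧
    -- the error bound is `O(max α)` as the step sizes tend to zero
    (∃ C > 0, ∃ α₀ > 0, ∀ α : Sym2 (Fin N) → ℝ,
      (∀ e ∈ G.edgeSet, 0 < α e ∧ α e ≤ α₀) →
      DEAN.errorBound G (DEAN.V f xs x0) θ Θ L θbar α ≤ C * DEAN.alphaMax G α) := by
  have hmemC : ∀ i, xs ∈ convexHull ℝ (DEAN.Cset f xs x0 i) := fun i =>
    subset_convexHull ℝ _ (DEAN.optimum_mem_Cset hf i)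
  have hθΘ : ∀ i, θ i ≤ Θ i := fun i => DEAN.le_of_hessBounds hn (hmemC i) (hθ i).2 (hΘ i).2
  have : Nonempty (Fin N) := ⟨⟨0, by omega⟩⟩
  have ht : 0 < ⨅ i, θ i := by
    obtain ⟨i, hi⟩ := exists_eq_ciInf_of_finite (f := θ)
    exact hi ▸ (hθ i).1
  have htT : (⨅ i, θ i) ≤ ⨆ i, Θ i :=
    (ciInf_le (Set.finite_range _).bddBelow ⟨0, by omega⟩).trans
      ((hθΘ _).trans (le_ciSup (Set.finite_range _).bddAbove _))
  refine ⟨fun α hα hdrop hαθ => ?_, DEAN.exists_errorBound_le hN hG (DEAN.V_nonneg hf x0)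
    (fun i => (hθ i).1) (fun i => (hΘ i).1) (fun i => (hL i).1) (fun i => (hθbar i).1)⟩
  have hpos : ∀ e ∈ G.edgeSet, 0 < α e := fun e he => (hα e he).1
  have hq0 := DEAN.rate_nonneg hN hG hpos ht htT
  have hq1 := DEAN.rate_lt_one hN hG hpos ht (ht.trans_le htT) hαθ
  have hrho : ∀ i, 0 < DEAN.rho G (DEAN.V f xs x0) θ Θ L α i := fun i =>
    DEAN.rho_pos hN hG hpos hdrop (hθΘ i) (hθ i).1 (hL i).1 (hmono i)
  exact ⟨⟨hq0, hq1, DEAN.eq_top_of_rate_eq_zero hN hG hpos ht htT⟩, hrho,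
    DEAN.exists_limit_of_stepSize hN hn hG hf hxs hx0 hθ hΘ hL hθbar hpos
      (fun x hx => DEAN.V_step_le hN hn hG hf hα hθ hθ' hΘ' hL' hdrop hx)
      ht (ht.trans_le htT) hq0 hq1 hrho⟩
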